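/- Let $A$ be a complex Banach algebra that is approximately unital, i.e. has a contractive two-sided approximate identity. Let $\widetilde A$ be its minimal multiplier unitization: $\widetilde A=A$ if $A$ is unital, and otherwise $\widetilde A=A+\mathbb C1$ with norm $\|a+\mu1\|=\sup\{\|ab+\mu b\| : b\in A,\ \|b\|\le 1\}$. An element $a\in A$ is *hermitian* if $\|\exp(ita)\|_{\widetilde A}=1$ for all $t\in\mathbb R$. An idempotent $e\in A$ is *ultrahermitian* if $\|exe+(1-e)y(1-e)\|\le 1$ for all $x,y\in\widetilde A$ with $\|x\|,\|y\|\le1$. An element $a\in A$ is *Moore–Penrose invertible* if there is a (necessarily unique) $a^\dagger\in A$ such that $a=aa^\dagger a$, $a^\dagger=a^\dagger aa^\dagger$, and $aa^\dagger$ and $a^\dagger a$ are hermitian. Let $\mathrm{PI}_{\mathrm{MP}}(A)$ be the set of *MP-partial isometries*, i.e. of Moore–Penrose invertible $a\in A$ with $\|a\|\le1$ and $\|a^\dagger\|\le1$. Two MP-partial isometries are *homotopic*, $a\simeq b$, if they are joined by a norm-continuous path in $\mathrm{PI}_{\mathrm{MP}}(A)$. Let $\mathfrak S_{\mathrm{pi}}(A)=\mathrm{PI}_{\mathrm{MP}}(A)/\!\simeq$,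 and write $[a]$ for the class of $a$. An *inverse semigroup* is a semigroup in which each $s$ has a unique generalized inverse $s^\dagger$, i.e. a unique element with $s=ss^\dagger s$ and $s^\dagger=s^\dagger ss^\dagger$. **Theorem.** (1) Suppose that all hermitian idempotents in $A$ are ultrahermitian and commute with each other. Then $\mathrm{PI}_{\mathrm{MP}}(A)$ is an inverse semigroup under the multiplication of $A$, in which the generalized inverse of $a$ is its Moore–Penrose inverse $a^\dagger$. Moreover, $\mathfrak S_{\mathrm{pi}}(A)$ is an inverse semigroup with the (well-defined) multiplication $[a][b]=[ab]$, in which $[a]^\dagger=[a^\dagger]$ for all $a\in\mathrm{PI}_{\mathrm{MP}}(A)$. The quotient map $\mathrm{PI}_{\mathrm{MP}}(A)\to\mathfrak S_{\mathrm{pi}}(A)$ is a homomorphism of inverse semigroups. (2) The hypothesis of (1), and hence its conclusion, holds in each of the following cases: - for some $p\in(1,\infty)\setminus\{2\}$, $A$ is an $L^p$-operator algebra, i.e. $A$ has an isometric representation $A\to\mathcal B(L^p(X,\mu))$ for some measure space $(X,\mu)$; - $A$ has an isometric representation $\varphi\colon A\to\mathcal B(L^1(X,\mu))$ for some measure space $(X,\mu)$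 that is nondegenerate, i.e. the linear span of $\{\varphi(a)\xi : a\in A,\ \xi\in L^1(X,\mu)\}$ is dense in $L^1(X,\mu)$. -/

import Mathlib

open Filter Topology MeasureTheory
open scoped ENNReal

universe u v

noncomputable section

namespace MPInv

/-! ### Hermitian elements and ultrahermitian idempotents of a unital Banach algebra -/

section Unital

variable {B : Type*} [NormedRing B] [NormedAlgebra ℂ B]

/-- `a` is hermitian in the unital algebra `B`: `‖exp(i t a)‖ = 1` for all real `t`. -/
def IsHermitianUnital (a : B) : Prop :=
  ∀ t : ℝ, ‖NormedSpace.exp (((t : ℂ) * Complex.I) • a)‖ = 1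

/-- `e` is an ultrahermitian idempotent in the unital algebra `B`:
`‖e a e + (1 - e) b (1 - e)‖ ≤ 1` for all contractions `a, b` in `B`. -/
def IsUltrahermitianUnital (e : B) : Prop :=
  IsIdempotentElem e ∧
    ∀ a b : B, ‖a‖ ≤ 1 → ‖b‖ ≤ 1 → ‖e * a * e + (1 - e) * b * (1 - e)‖ ≤ 1

theorem exp_smul_idempotent {e : B} (he : IsIdempotentElem e) (z : ℂ) :
    NormedSpace.exp (z • e) = (1 - e) + Complex.exp z • e := by
  have h1 : HasSum (fun n : ℕ => ((n.factorial : ℂ)⁻¹ • z ^ n)) (Complex.exp z) := by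
    rw [Complex.exp_eq_exp_ℂ]
    exact NormedSpace.exp_series_hasSum_exp' (𝕂 := ℂ) z
  have h2 : HasSum (fun n : ℕ => ((n.factorial : ℂ)⁻¹ • z ^ n) • e) (Complex.exp z • e) :=
    h1.smul_const e
  have h3 : HasSum (fun n : ℕ => if n = 0 then (1 - e) else 0) (1 - e) :=
    hasSum_ite_eq 0 (1 - e)
  have h4 := h3.add h2
  rw [NormedSpace.exp_eq_tsum ℂ]
  refine Eq.trans (tsum_congr fun n => ?_) h4.tsum_eq
  rcases n with _ | n
  · simp
  · rw [smul_pow, he.pow_succ_eq]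
    simp [smul_smul]

theorem eq_zero_of_norm_one_add_le {m : B} (hm : m * m = 0) (h : ‖1 + m‖ ≤ 1) : m = 0 := by
  have hp : ∀ k : ℕ, (1 + m) ^ (k + 1) = 1 + ((k + 1 : ℕ) : ℂ) • m := by
    intro k
    induction k with
    | zero => simp
    | succ k ih =>
      rw [pow_succ, ih, mul_add, mul_one, add_mul, one_mul, smul_mul_assoc, hm]
      push_cast
      module
  have hb : ∀ k : ℕ, ((k + 1 : ℕ) : ℝ) * ‖m‖ ≤ 1 + ‖(1 : B)‖ := by
    intro k
    have h1 : ‖(1 + m) ^ (k + 1)‖ ≤ 1 :=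
      (norm_pow_le' _ k.succ_pos).trans (pow_le_one₀ (norm_nonneg _) h)
    have h2 : ((k + 1 : ℕ) : ℂ) • m = (1 + m) ^ (k + 1) - 1 := by rw [hp k]; abel
    calc ((k + 1 : ℕ) : ℝ) * ‖m‖ = ‖((k + 1 : ℕ) : ℂ) • m‖ := by
          rw [norm_smul, Complex.norm_natCast]
      _ ≤ ‖(1 + m) ^ (k + 1)‖ + ‖(1 : B)‖ := by rw [h2]; exact norm_sub_le _ _
      _ ≤ 1 + ‖(1 : B)‖ := by gcongr
  by_contra hne
  have hpos : 0 < ‖m‖ := norm_pos_iff.mpr hne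
  obtain ⟨k, hk⟩ := exists_nat_gt ((1 + ‖(1 : B)‖) / ‖m‖)
  rw [div_lt_iff₀ hpos] at hk
  have := hb k
  push_cast at this
  nlinarith

theorem norm_reflection_le {e : B} (he : IsIdempotentElem e) (h : IsHermitianUnital e) :
    ‖1 - (2 : ℂ) • e‖ ≤ 1 := by
  have h1 := (h Real.pi).le
  rw [exp_smul_idempotent he, Complex.exp_pi_mul_I] at h1
  have h2 : 1 - (2 : ℂ) • e = (1 - e) + (-1 : ℂ) • e := by module
  rwa [h2]

/-- Two hermitian idempotents with the same range, or with the same kernel, are equal. -/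
theorem hermitian_idempotent_eq {e f : B} (he : IsIdempotentElem e) (hf : IsIdempotentElem f)
    (he' : IsHermitianUnital e) (hf' : IsHermitianUnital f)
    (h : (e * f = f ∧ f * e = e) ∨ (e * f = e ∧ f * e = f)) : e = f := by
  have hn : ‖(1 - (2 : ℂ) • e) * (1 - (2 : ℂ) • f)‖ ≤ 1 :=
    (norm_mul_le _ _).trans (mul_le_one₀ (norm_reflection_le he he') (norm_nonneg _)
      (norm_reflection_le hf hf'))
  have hx : (1 - (2 : ℂ) • e) * (1 - (2 : ℂ) • f)
      = 1 - (2 : ℂ) • e - (2 : ℂ) • f + (4 : ℂ) • (e * f) := by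
    simp only [mul_sub, sub_mul, one_mul, mul_one, smul_mul_smul_comm]
    module
  rw [hx] at hn
  have he2 : e * e = e := he
  have hf2 : f * f = f := hf
  rcases h with ⟨h1, h2⟩ | ⟨h1, h2⟩
  · have h3 : (1 : B) - (2 : ℂ) • e - (2 : ℂ) • f + (4 : ℂ) • (e * f)
        = 1 + (2 : ℂ) • (f - e) := by rw [h1]; module
    rw [h3] at hn
    have := eq_zero_of_norm_one_add_le (m := (2 : ℂ) • (f - e)) (by
      rw [smul_mul_smul_comm, mul_sub, sub_mul, sub_mul, h1, h2, he2, hf2]; simp) hn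
    rw [smul_eq_zero_iff_right (by norm_num), sub_eq_zero] at this
    exact this.symm
  · have h3 : (1 : B) - (2 : ℂ) • e - (2 : ℂ) • f + (4 : ℂ) • (e * f)
        = 1 + (2 : ℂ) • (e - f) := by rw [h1]; module
    rw [h3] at hn
    have := eq_zero_of_norm_one_add_le (m := (2 : ℂ) • (e - f)) (by
      rw [smul_mul_smul_comm, mul_sub, sub_mul, sub_mul, h1, h2, he2, hf2]; simp) hn
    rw [smul_eq_zero_iff_right (by norm_num), sub_eq_zero] at this
    exact this

end Unital

/-! ### Approximately unital Banach algebras and the minimal multiplier unitization -/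

section ApproxUnital

variable (A : Type u) [NonUnitalNormedRing A] [NormedSpace ℂ A]

/-- `A` has a contractive two-sided approximate identity (stated with a proper filter instead of
a net: the two notions give the same class of algebras). -/
def ApproximatelyUnital : Prop :=
  ∃ l : Filter A, l.IsApproximateUnit ∧ ∀ᶠ e in l, ‖e‖ ≤ 1

variable [IsScalarTower ℂ A A] [SMulCommClass ℂ A A]

/-- The minimal multiplier unitization `Ã = A + ℂ 1`, as the unital subalgebra of the bounded
operators on `A` formed by the operators `b ↦ a b + μ b`; its norm, the operator norm, is
`‖a + μ 1‖ = sup {‖a b + μ b‖ : ‖b‖ ≤ 1}`. If `A` has a contractive unit then the canonical map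
`A → Ã` is an isometric isomorphism (`toMinUnitization_isometry`,
`toMinUnitization_surjective_of_unit` below), so that `Ã = A` in that case. -/
def MinUnitization : Subalgebra ℂ (A →L[ℂ] A) where
  carrier := {T | ∃ (a : A) (μ : ℂ), T = ContinuousLinearMap.mul ℂ A a + μ • 1}
  mul_mem' := by
    rintro _ _ ⟨a, μ, rfl⟩ ⟨b, ν, rfl⟩
    refine ⟨a * b + ν • a + μ • b, μ * ν, ?_⟩
    ext x
    simp [mul_add, add_mul, mul_assoc, smul_smul, mul_comm ν μ]
    abel
  add_mem' := by
    rintro _ _ ⟨a, μ, rfl⟩ ⟨b, ν, rfl⟩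
    refine ⟨a + b, μ + ν, ?_⟩
    rw [map_add]
    module
  algebraMap_mem' := by
    intro r
    refine ⟨0, r, ?_⟩
    rw [map_zero, zero_add, Algebra.algebraMap_eq_smul_one]

variable {A}

/-- The canonical map `A → Ã`: an element `a` acts on `A` by left multiplication. -/
def toMinUnitization (a : A) : MinUnitization A :=
  ⟨ContinuousLinearMap.mul ℂ A a, a, 0, by simp⟩

theorem toMinUnitization_mul (a b : A) :
    toMinUnitization (a * b) = toMinUnitization a * toMinUnitization b := by
  apply Subtype.ext
  ext x
  simp [toMinUnitization, mul_assoc]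

theorem toMinUnitization_norm (hA : ApproximatelyUnital A) (a : A) :
    ‖toMinUnitization a‖ = ‖a‖ := by
  change ‖ContinuousLinearMap.mul ℂ A a‖ = ‖a‖
  refine le_antisymm (ContinuousLinearMap.opNorm_mul_apply_le ℂ A a) ?_
  obtain ⟨l, hl, hl1⟩ := hA
  have := hl.neBot
  refine le_of_tendsto (hl.tendsto_mul_left a).norm ?_
  filter_upwards [hl1] with e he
  calc ‖a * e‖ = ‖ContinuousLinearMap.mul ℂ A a e‖ := by simp
    _ ≤ ‖ContinuousLinearMap.mul ℂ A a‖ * ‖e‖ := ContinuousLinearMap.le_opNorm _ _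
    _ ≤ ‖ContinuousLinearMap.mul ℂ A a‖ := mul_le_of_le_one_right (norm_nonneg _) he

theorem toMinUnitization_isometry (hA : ApproximatelyUnital A) :
    Isometry (toMinUnitization : A → MinUnitization A) := by
  refine Isometry.of_dist_eq fun a b => ?_
  rw [dist_eq_norm, dist_eq_norm, ← toMinUnitization_norm hA (a - b)]
  congr 1
  apply Subtype.ext
  simp [toMinUnitization]

theorem toMinUnitization_surjective_of_unit {u : A} (hu : ∀ x : A, u * x = x) :
    Function.Surjective (toMinUnitization : A → MinUnitization A) := by
  rintro ⟨_, a, μ, rfl⟩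
  refine ⟨a + μ • u, Subtype.ext ?_⟩
  ext x
  simp [toMinUnitization, hu]

/-- `a ∈ A` is hermitian if it is hermitian in `Ã`. -/
def IsHermitian (a : A) : Prop := IsHermitianUnital (toMinUnitization a)

/-- `e ∈ A` is an ultrahermitian idempotent if its image in `Ã` is. -/
def IsUltrahermitian (e : A) : Prop := IsUltrahermitianUnital (toMinUnitization e)

/-! ### Moore-Penrose inverses and MP-partial isometries -/

/-- `b` is a Moore-Penrose inverse of `a` in `A`. -/
structure IsMPInverse (a b : A) : Prop where
  left : a = a * b * a
  right : b = b * a * b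
  herm_left : IsHermitian (a * b)
  herm_right : IsHermitian (b * a)

/-- Moore-Penrose inverses are unique. -/
theorem IsMPInverse.unique (hA : ApproximatelyUnital A) {a b c : A}
    (hb : IsMPInverse a b) (hc : IsMPInverse a c) : b = c := by
  have key : ∀ e f : A, e * e = e → f * f = f → IsHermitian e → IsHermitian f →
      ((e * f = f ∧ f * e = e) ∨ (e * f = e ∧ f * e = f)) → e = f := by
    intro e f he hf he' hf' h
    refine (toMinUnitization_isometry hA).injective
      (hermitian_idempotent_eq (B := MinUnitization A) ?_ ?_ he' hf' ?_)
    · rw [IsIdempotentElem, ← toMinUnitization_mul, he]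
    · rw [IsIdempotentElem, ← toMinUnitization_mul, hf]
    · simp only [← toMinUnitization_mul]
      rcases h with ⟨h1, h2⟩ | ⟨h1, h2⟩
      · exact Or.inl ⟨by rw [h1], by rw [h2]⟩
      · exact Or.inr ⟨by rw [h1], by rw [h2]⟩
  have b1 := hb.left.symm
  have b2 := hb.right.symm
  have c1 := hc.left.symm
  have c2 := hc.right.symm
  have h1 : a * b = a * c := by
    refine key _ _ ?_ ?_ hb.herm_left hc.herm_left (Or.inl ⟨?_, ?_⟩)
    · rw [← mul_assoc, b1]
    · rw [← mul_assoc, c1]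
    · rw [← mul_assoc, b1]
    · rw [← mul_assoc, c1]
  have h2 : b * a = c * a := by
    refine key _ _ ?_ ?_ hb.herm_right hc.herm_right (Or.inr ⟨?_, ?_⟩)
    · rw [← mul_assoc, b2]
    · rw [← mul_assoc, c2]
    · rw [mul_assoc, ← mul_assoc a, c1]
    · rw [mul_assoc, ← mul_assoc a, b1]
  calc b = b * a * b := hb.right
    _ = c * (a * b) := by rw [h2, mul_assoc]
    _ = c * a * c := by rw [h1, mul_assoc]
    _ = c := c2

/-- `a` is Moore-Penrose invertible in `A`. -/
def IsMPInvertible (a : A) : Prop := ∃ b : A, IsMPInverse a b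

open Classical in
/-- The Moore-Penrose inverse `a†` of a Moore-Penrose invertible element `a`
(and `0` if `a` is not Moore-Penrose invertible). -/
def mpInverse (a : A) : A := if h : IsMPInvertible a then h.choose else 0

theorem isMPInverse_mpInverse {a : A} (h : IsMPInvertible a) : IsMPInverse a (mpInverse a) := by
  rw [mpInverse, dif_pos h]
  exact h.choose_spec

variable (A)

/-- The set of MP-partial isometries of `A`. -/
def PIMP : Set A := {a | IsMPInvertible a ∧ ‖a‖ ≤ 1 ∧ ‖mpInverse a‖ ≤ 1}

/-- The set of homotopy classes of MP-partial isometries, that is, the quotient of `PIMP A`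
(with the norm topology) by the relation of being joined by a continuous path in `PIMP A`. -/
abbrev HomotopyClasses : Type _ := ZerothHomotopy (PIMP A)

/-- Hermitian idempotents of `A` are ultrahermitian. -/
def HermitianIdempotentsUltrahermitian : Prop :=
  ∀ e : A, IsIdempotentElem e → IsHermitian e → IsUltrahermitian e

/-- Hermitian idempotents of `A` commute. -/
def HermitianIdempotentsCommute : Prop :=
  ∀ e f : A, IsIdempotentElem e → IsHermitian e → IsIdempotentElem f → IsHermitian f →
    e * f = f * e

/-! ### `L^p`-operator algebras -/

/-- `A` is an `L^p`-operator algebra: it has an isometric representation on the `L^p`-space of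
some measure space. -/
def IsLpOperatorAlgebra (p : ℝ≥0∞) [Fact (1 ≤ p)] : Prop :=
  ∃ (X : Type v) (_ : MeasurableSpace X) (μ : Measure X)
    (φ : A →ₙₐ[ℂ] (Lp ℂ p μ →L[ℂ] Lp ℂ p μ)), Isometry φ

/-- `A` has an isometric representation `φ` on the `L^p`-space `E` of some measure space that is
nondegenerate: the linear span of `{φ(a) ξ : a ∈ A, ξ ∈ E}` is dense in `E`. -/
def HasNondegenerateLpRepresentation (p : ℝ≥0∞) [Fact (1 ≤ p)] : Prop :=
  ∃ (X : Type v) (_ : MeasurableSpace X) (μ : Measure X)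
    (φ : A →ₙₐ[ℂ] (Lp ℂ p μ →L[ℂ] Lp ℂ p μ)), Isometry φ ∧
      Dense (Submodule.span ℂ {η : Lp ℂ p μ | ∃ (a : A) (ξ : Lp ℂ p μ), η = φ a ξ} :
        Set (Lp ℂ p μ))

end ApproxUnital

/-! ### Inverse semigroups -/

/-- An inverse semigroup: a semigroup in which every `s` has a unique generalized inverse, i.e. a
unique `t` with `s = s t s` and `t = t s t`. This `t` is written `s⁻¹` (or `s†`). -/
class InverseSemigroup (S : Type*) extends Semigroup S, Inv S where
  mul_inv_mul : ∀ s : S, s = s * s⁻¹ * s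
  inv_mul_inv : ∀ s : S, s⁻¹ = s⁻¹ * s * s⁻¹
  inv_unique : ∀ s t : S, s = s * t * s → t = t * s * t → t = s⁻¹

end MPInv

end

namespace MPInv

/-! ### Inverse semigroups from commuting projections -/

/-! For the first part, let `a`, `b` be MP-partial isometries. Since `a†a` and `bb†` commute, `b†a†`
is a generalized inverse of `ab`. Its range projection is `g = a(bb†)a†`. For `|w| = 1` the element
`1 - g + wg` is the sum of a contraction in the corner of `p = aa†` and `1 - p`, so
ultrahermitianness of `p` makes `g` hermitian (`IsHermitianUnital.conj`). Commuting projections and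
the involution `†` then force generalized inverses to be unique. For homotopy classes, two
MP-partial isometries at distance less than `1/2` have equal projections, because the defect is an
idempotent of norm below 1. Hence `†` is continuous (`norm_mpInverse_sub_le`) and respects homotopy,
and all the identities descend.

For the second part, everything follows from one property, `SeparatesSupports`: vectors `φ(ea)ζ` and
`φ(b - eb)ξ` have disjoint supports. Additivity of `‖·‖^p` on disjoint functions then makes `e`
ultrahermitian, and comparing supports makes two such idempotents commute. Hermitianness makes the
elements `1 - e + we` contractive. For `1 < p`, `p ≠ 2`, smoothness of the norm shows that the
duality map `J` is affine in `conj w` along `wf + g`. Pointwise, the parallelogram law then makes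
`(α + t)^(p-1) + (α - t)^(p-1)` independent of `w`, where `t = Re(wc)` and `c = 2f·conj g`; this
forces `c = 0`. For `p = 1`, a second-order estimate shows that `e` commutes with restriction to
measurable sets, so norm inequalities localize to pointwise ones. -/

/-- A semigroup with an involutive generalized inverse `s ↦ s⁻¹` for which all the projections
`s s⁻¹` commute is an inverse semigroup. -/
@[reducible] def InverseSemigroup.ofCommute {S : Type*} [Semigroup S] [Inv S]
    (h1 : ∀ s : S, s = s * s⁻¹ * s) (h2 : ∀ s : S, s⁻¹⁻¹ = s)
    (hc : ∀ s t : S, (s * s⁻¹) * (t * t⁻¹) = (t * t⁻¹) * (s * s⁻¹)) :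
    InverseSemigroup S where
  mul_inv_mul := h1
  inv_mul_inv s := by simpa only [h2] using h1 s⁻¹
  inv_unique := by
    have h1' : ∀ s : S, s⁻¹ = s⁻¹ * s * s⁻¹ := fun s => by simpa only [h2] using h1 s⁻¹
    -- idempotents are projections
    have hproj : ∀ x : S, x * x = x → x = x * x⁻¹ := by
      intro x hx
      -- An idempotent `x` makes `x⁻¹` a product of two commuting projections, hence idempotent;
      -- this in turn gives `x = x⁻¹`.
      have e1 : x⁻¹ = (x⁻¹ * x) * (x * x⁻¹) := by
        calc x⁻¹ = x⁻¹ * (x * x) * x⁻¹ := by rw [hx]; exact h1' x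
          _ = _ := by simp only [mul_assoc]
      have hcx : (x⁻¹ * x) * (x * x⁻¹) = (x * x⁻¹) * (x⁻¹ * x) := by
        have := hc x⁻¹ x
        rwa [h2] at this
      have hi : x⁻¹ * x⁻¹ = x⁻¹ := by
        have ha : (x * x⁻¹) * (x * x⁻¹) = x * x⁻¹ := by rw [← mul_assoc, ← h1]
        have hb : (x⁻¹ * x) * (x⁻¹ * x) = x⁻¹ * x := by rw [← mul_assoc, ← h1']
        calc x⁻¹ * x⁻¹ = ((x⁻¹ * x) * (x * x⁻¹)) * ((x * x⁻¹) * (x⁻¹ * x)) := by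
              rw [← hcx, ← e1]
          _ = (x⁻¹ * x) * ((x * x⁻¹) * (x * x⁻¹)) * (x⁻¹ * x) := by simp only [mul_assoc]
          _ = (x⁻¹ * x) * ((x⁻¹ * x) * (x * x⁻¹)) := by rw [ha, mul_assoc, ← hcx]
          _ = x⁻¹ := by rw [← mul_assoc, hb, ← e1]
      have e2 : x = x⁻¹ := by
        calc x = x * (x⁻¹ * x⁻¹) * x := by rw [hi]; exact h1 x
          _ = (x * x⁻¹) * (x⁻¹ * x) := by simp only [mul_assoc]
          _ = x⁻¹ := by rw [← hcx, ← e1]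
      rw [← e2, hx]
    intro s t hs ht
    -- Two commuting idempotents that absorb each other on the same side are equal.
    have hst : s * t = s * s⁻¹ := by
      have hidem : s * t * (s * t) = s * t := by rw [← mul_assoc, ← hs]
      have hcm := hc (s * t) s
      rw [← hproj _ hidem] at hcm
      calc s * t = s * s⁻¹ * (s * t) := by rw [← mul_assoc, ← h1]
        _ = s * t * (s * s⁻¹) := hcm.symm
        _ = s * s⁻¹ := by rw [← mul_assoc, ← hs]
    have hts : t * s = s⁻¹ * s := by
      have hidem : t * s * (t * s) = t * s := by rw [← mul_assoc, ← ht]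
      have hcm := hc (t * s) s⁻¹
      rw [← hproj _ hidem, h2] at hcm
      calc t * s = t * s * (s⁻¹ * s) := by rw [mul_assoc t, ← mul_assoc s, ← h1]
        _ = s⁻¹ * s * (t * s) := hcm
        _ = s⁻¹ * s := by rw [mul_assoc, ← mul_assoc s, ← hs]
    calc t = t * s * t := ht
      _ = s⁻¹ * (s * t) := by rw [hts, mul_assoc]
      _ = s⁻¹ := by rw [hst, ← mul_assoc, ← h1']

/-! ### Hermitian idempotents -/

section Unital

variable {B : Type*} [NormedRing B] [NormedAlgebra ℂ B]

theorem IsHermitianUnital.norm_one {a : B} (h : IsHermitianUnital a) : ‖(1 : B)‖ = 1 := by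
  simpa using h 0

/-- The exponentials at `t` and `-t` are mutually inverse, so upper bounds by 1 at both already
force norm exactly 1. -/
theorem isHermitianUnital_of_idempotent {g : B} (hg : IsIdempotentElem g) (h1 : ‖(1 : B)‖ = 1)
    (h : ∀ t : ℝ, ‖(1 - g) + Complex.exp (t * Complex.I) • g‖ ≤ 1) : IsHermitianUnital g := by
  intro t
  rw [exp_smul_idempotent hg]
  refine le_antisymm (h t) ?_
  have hg' : g * g = g := hg
  have hprod : ((1 - g) + Complex.exp (t * Complex.I) • g) *
      ((1 - g) + Complex.exp ((-t : ℝ) * Complex.I) • g) = 1 := by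
    have hz : Complex.exp (t * Complex.I) * Complex.exp ((-t : ℝ) * Complex.I) = 1 := by
      rw [← Complex.exp_add]; simp
    have hexpand : ∀ w z : ℂ, ((1 - g) + w • g) * ((1 - g) + z • g) = 1 + (w * z - 1) • g := by
      intro w z
      simp only [mul_add, add_mul, mul_sub, sub_mul, one_mul, mul_one, smul_mul_assoc,
        mul_smul_comm, hg']
      module
    rw [hexpand, hz, sub_self, zero_smul, add_zero]
  have h2 := norm_mul_le ((1 - g) + Complex.exp (t * Complex.I) • g)
      ((1 - g) + Complex.exp ((-t : ℝ) * Complex.I) • g)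
  rw [hprod, h1] at h2
  exact h2.trans (mul_le_of_le_one_right (norm_nonneg _) (h (-t)))

/-- Conjugating a hermitian idempotent by a contractive pair of generalized inverses with
ultrahermitian range projection gives a hermitian element. -/
theorem IsHermitianUnital.conj {a b f : B} (hab : a * b * a = a) (hba : b * a * b = b)
    (hf : IsIdempotentElem f) (hfh : IsHermitianUnital f)
    (hp : IsUltrahermitianUnital (a * b)) (ha : ‖a‖ ≤ 1) (hb : ‖b‖ ≤ 1)
    (hg : IsIdempotentElem (a * f * b)) : IsHermitianUnital (a * f * b) := by
  refine isHermitianUnital_of_idempotent hg hfh.norm_one fun t => ?_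
  set w := Complex.exp (t * Complex.I)
  have hX : ‖(1 - f) + w • f‖ ≤ 1 := by
    have := (hfh t).le
    rwa [exp_smul_idempotent hf] at this
  -- Filling the complementary corner with `1` yields `a(1 - f + wf)b + (1 - ab) = 1 - afb + w·afb`.
  have hle := hp.2 (a * ((1 - f) + w • f) * b) 1
    ((norm_mul_le _ _).trans (mul_le_one₀ ((norm_mul_le _ _).trans
      (mul_le_one₀ ha (norm_nonneg _) hX)) (norm_nonneg _) hb)) hfh.norm_one.le
  have h1 : a * b * (a * ((1 - f) + w • f) * b) * (a * b) = a * ((1 - f) + w • f) * b := by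
    calc _ = (a * b * a) * ((1 - f) + w • f) * (b * a * b) := by simp only [mul_assoc]
      _ = _ := by rw [hab, hba]
  have hpp : (1 - a * b) * 1 * (1 - a * b) = 1 - a * b := by
    rw [mul_one]; exact hp.1.one_sub
  rw [h1, hpp] at hle
  convert hle using 2
  simp only [mul_add, add_mul, mul_sub, sub_mul, mul_one, smul_mul_assoc, mul_smul_comm]
  module

end Unital

/-! ### Products, continuity of the Moore-Penrose inverse, and the homotopy quotient -/

section MoorePenrose

theorem eq_zero_of_isIdempotentElem_of_norm_lt_one {R : Type*} [NonUnitalNormedRing R]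
    {x : R} (hx : IsIdempotentElem x) (h : ‖x‖ < 1) : x = 0 := by
  by_contra hne
  have hpos : 0 < ‖x‖ := norm_pos_iff.mpr hne
  have h1 : ‖x‖ ≤ ‖x‖ * ‖x‖ := by
    calc ‖x‖ = ‖x * x‖ := by rw [hx.eq]
      _ ≤ _ := norm_mul_le _ _
  nlinarith

variable {A : Type u} [NonUnitalNormedRing A] [NormedSpace ℂ A]
  [IsScalarTower ℂ A A] [SMulCommClass ℂ A A]

theorem IsMPInverse.symm {a b : A} (h : IsMPInverse a b) : IsMPInverse b a :=
  ⟨h.right, h.left, h.herm_right, h.herm_left⟩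

theorem IsMPInverse.isIdempotentElem {a b : A} (h : IsMPInverse a b) :
    IsIdempotentElem (a * b) := by
  rw [IsIdempotentElem, ← mul_assoc, ← h.left]

theorem IsMPInverse.mpInverse_eq (hA : ApproximatelyUnital A) {a b : A} (h : IsMPInverse a b) :
    mpInverse a = b :=
  (isMPInverse_mpInverse ⟨b, h⟩).unique hA h

theorem isIdempotentElem_toMinUnitization {e : A} (he : IsIdempotentElem e) :
    IsIdempotentElem (toMinUnitization e) := by
  rw [IsIdempotentElem, ← toMinUnitization_mul, he]

theorem isHermitian_conj (hA : ApproximatelyUnital A)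
    (hU : HermitianIdempotentsUltrahermitian A) (hC : HermitianIdempotentsCommute A)
    {a b f : A} (hab : IsMPInverse a b) (ha : ‖a‖ ≤ 1) (hb : ‖b‖ ≤ 1)
    (hf : IsIdempotentElem f) (hfh : IsHermitian f) : IsHermitian (a * f * b) := by
  have hf2 : f * f = f := hf
  have hg : IsIdempotentElem (a * f * b) := by
    have hc := hC _ f hab.symm.isIdempotentElem hab.herm_right hf hfh
    calc a * f * b * (a * f * b) = a * f * (b * a * f) * b := by simp only [mul_assoc]
      _ = a * (f * f) * (b * a * b) := by rw [hc]; simp only [mul_assoc]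
      _ = a * f * b := by rw [hf2, ← hab.right]
  have h := IsHermitianUnital.conj (a := toMinUnitization a) (b := toMinUnitization b)
    (f := toMinUnitization f) ?_ ?_ (isIdempotentElem_toMinUnitization hf) hfh ?_ ?_ ?_ ?_
  · simpa only [IsHermitian, toMinUnitization_mul] using h
  · simp only [← toMinUnitization_mul, ← hab.left]
  · simp only [← toMinUnitization_mul, ← hab.right]
  · rw [← toMinUnitization_mul]; exact hU _ hab.isIdempotentElem hab.herm_left
  · rwa [toMinUnitization_norm hA]
  · rwa [toMinUnitization_norm hA]
  · simp only [← toMinUnitization_mul]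
    exact isIdempotentElem_toMinUnitization hg

/-- Commutation of `a'a` with `bb'` gives the two algebraic identities. The range projection is
`bb'` conjugated by `(a, a')`, and the source projection is `a'a` conjugated by `(b', b)`. -/
theorem IsMPInverse.mul (hA : ApproximatelyUnital A)
    (hU : HermitianIdempotentsUltrahermitian A) (hC : HermitianIdempotentsCommute A)
    {a a' b b' : A} (ha : IsMPInverse a a') (hb : IsMPInverse b b')
    (hna : ‖a‖ ≤ 1) (hna' : ‖a'‖ ≤ 1) (hnb : ‖b‖ ≤ 1) (hnb' : ‖b'‖ ≤ 1) :
    IsMPInverse (a * b) (b' * a') := by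
  have hc := hC _ _ ha.symm.isIdempotentElem ha.herm_right hb.isIdempotentElem hb.herm_left
  refine ⟨?_, ?_, ?_, ?_⟩
  · calc a * b = (a * a' * a) * (b * b' * b) := by rw [← ha.left, ← hb.left]
      _ = a * ((a' * a) * (b * b')) * b := by simp only [mul_assoc]
      _ = a * b * (b' * a') * (a * b) := by rw [hc]; simp only [mul_assoc]
  · calc b' * a' = (b' * b * b') * (a' * a * a') := by rw [← ha.right, ← hb.right]
      _ = b' * ((b * b') * (a' * a)) * a' := by simp only [mul_assoc]
      _ = b' * a' * (a * b) * (b' * a') := by rw [← hc]; simp only [mul_assoc]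
  · have := isHermitian_conj hA hU hC ha hna hna' hb.isIdempotentElem hb.herm_left
    simpa only [mul_assoc] using this
  · have := isHermitian_conj hA hU hC hb.symm hnb' hnb ha.symm.isIdempotentElem ha.herm_right
    simpa only [mul_assoc] using this

theorem mem_PIMP_of_isMPInverse (hA : ApproximatelyUnital A) {a b : A} (h : IsMPInverse a b)
    (ha : ‖a‖ ≤ 1) (hb : ‖b‖ ≤ 1) : a ∈ PIMP A :=
  ⟨⟨b, h⟩, ha, by rwa [h.mpInverse_eq hA]⟩

theorem isMPInverse_of_mem_PIMP {a : A} (ha : a ∈ PIMP A) : IsMPInverse a (mpInverse a) :=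
  isMPInverse_mpInverse ha.1

theorem mpInverse_mem_PIMP (hA : ApproximatelyUnital A) {a : A} (ha : a ∈ PIMP A) :
    mpInverse a ∈ PIMP A :=
  mem_PIMP_of_isMPInverse hA (isMPInverse_of_mem_PIMP ha).symm ha.2.2 ha.2.1

theorem mpInverse_mpInverse (hA : ApproximatelyUnital A) {a : A} (ha : a ∈ PIMP A) :
    mpInverse (mpInverse a) = a :=
  (isMPInverse_of_mem_PIMP ha).symm.mpInverse_eq hA

theorem mul_mem_PIMP (hA : ApproximatelyUnital A)
    (hU : HermitianIdempotentsUltrahermitian A) (hC : HermitianIdempotentsCommute A)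
    {a b : A} (ha : a ∈ PIMP A) (hb : b ∈ PIMP A) : a * b ∈ PIMP A :=
  mem_PIMP_of_isMPInverse hA ((isMPInverse_of_mem_PIMP ha).mul hA hU hC
      (isMPInverse_of_mem_PIMP hb) ha.2.1 ha.2.2 hb.2.1 hb.2.2)
    ((norm_mul_le _ _).trans (mul_le_one₀ ha.2.1 (norm_nonneg _) hb.2.1))
    ((norm_mul_le _ _).trans (mul_le_one₀ hb.2.2 (norm_nonneg _) ha.2.2))

/-- The range projections of nearby MP-partial isometries agree. -/
theorem mul_mpInverse_eq_of_norm_sub_lt (hC : HermitianIdempotentsCommute A) {a a' b b' : A}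
    (ha : IsMPInverse a a') (hb : IsMPInverse b b') (hna : ‖a‖ ≤ 1) (hna' : ‖a'‖ ≤ 1)
    (hnb : ‖b‖ ≤ 1) (hnb' : ‖b'‖ ≤ 1) (h : ‖b - a‖ < 1 / 2) : a * a' = b * b' := by
  have key : ∀ a a' b b' : A, IsMPInverse a a' → IsMPInverse b b' → ‖a‖ ≤ 1 → ‖a'‖ ≤ 1 →
      ‖b‖ ≤ 1 → ‖b'‖ ≤ 1 → ‖b - a‖ < 1 / 2 → b * b' = a * a' * (b * b') := by
    intro a a' b b' ha hb hna hna' hnb hnb' h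
    have hc := hC _ _ ha.isIdempotentElem ha.herm_left hb.isIdempotentElem hb.herm_left
    have hp : a * a' * (a * a') = a * a' := ha.isIdempotentElem
    have hq : b * b' * (b * b') = b * b' := hb.isIdempotentElem
    have hpq : a * a' * (b * b') * (a * a' * (b * b')) = a * a' * (b * b') := by
      calc _ = a * a' * ((b * b') * (a * a')) * (b * b') := by simp only [mul_assoc]
        _ = (a * a' * (a * a')) * (b * b' * (b * b')) := by rw [← hc]; simp only [mul_assoc]
        _ = _ := by rw [hp, hq]
    have hidem : IsIdempotentElem (b * b' - a * a' * (b * b')) := by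
      have h1 : b * b' * (a * a' * (b * b')) = a * a' * (b * b') := by
        rw [← mul_assoc, ← hc, mul_assoc, hq]
      have h2 : a * a' * (b * b') * (b * b') = a * a' * (b * b') := by rw [mul_assoc, hq]
      rw [IsIdempotentElem, mul_sub, sub_mul, sub_mul, hq, h1, h2, hpq]
      abel
    -- The defect is `(1 - aa')bb'`. Since `(1 - aa')a = 0`, `b` may be replaced by `b - a`, so its
    -- norm is at most `2‖b - a‖`; hence the threshold `1/2`.
    have hform : b * b' - a * a' * (b * b') = (b - a) * b' - a * a' * ((b - a) * b') := by
      have h3 : a * a' * (a * b') = a * b' := by rw [← mul_assoc, ← ha.left]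
      rw [sub_mul, mul_sub, h3]
      abel
    have hsmall : ‖(b - a) * b'‖ ≤ ‖b - a‖ :=
      (norm_mul_le _ _).trans (mul_le_of_le_one_right (norm_nonneg _) hnb')
    have hpn : ‖a * a'‖ ≤ 1 := (norm_mul_le _ _).trans (mul_le_one₀ hna (norm_nonneg _) hna')
    have hlt : ‖b * b' - a * a' * (b * b')‖ < 1 := by
      rw [hform]
      calc _ ≤ ‖(b - a) * b'‖ + ‖a * a' * ((b - a) * b')‖ := norm_sub_le _ _
        _ ≤ ‖(b - a) * b'‖ + ‖(b - a) * b'‖ := by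
          gcongr
          exact (norm_mul_le _ _).trans (mul_le_of_le_one_left (norm_nonneg _) hpn)
        _ < 1 := by linarith
    exact sub_eq_zero.mp (eq_zero_of_isIdempotentElem_of_norm_lt_one hidem hlt)
  rw [key b b' a a' hb ha hnb hnb' hna hna' (by rwa [norm_sub_rev]),
    hC _ _ hb.isIdempotentElem hb.herm_left ha.isIdempotentElem ha.herm_left]
  exact (key a a' b b' ha hb hna hna' hnb hnb' h).symm

/-- The mirror image for source projections: the defect is now `b'(b - a)(1 - a'a)`. -/
theorem mul_mpInverse_eq_of_norm_sub_lt' (hC : HermitianIdempotentsCommute A) {a a' b b' : A}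
    (ha : IsMPInverse a a') (hb : IsMPInverse b b') (hna : ‖a‖ ≤ 1) (hna' : ‖a'‖ ≤ 1)
    (hnb : ‖b‖ ≤ 1) (hnb' : ‖b'‖ ≤ 1) (h : ‖b - a‖ < 1 / 2) : a' * a = b' * b := by
  have key : ∀ a a' b b' : A, IsMPInverse a a' → IsMPInverse b b' → ‖a‖ ≤ 1 → ‖a'‖ ≤ 1 →
      ‖b‖ ≤ 1 → ‖b'‖ ≤ 1 → ‖b - a‖ < 1 / 2 → b' * b = b' * b * (a' * a) := by
    intro a a' b b' ha hb hna hna' hnb hnb' h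
    have hc := hC _ _ ha.symm.isIdempotentElem ha.herm_right hb.symm.isIdempotentElem
      hb.herm_right
    have hp : a' * a * (a' * a) = a' * a := ha.symm.isIdempotentElem
    have hq : b' * b * (b' * b) = b' * b := hb.symm.isIdempotentElem
    have hpq : b' * b * (a' * a) * (b' * b * (a' * a)) = b' * b * (a' * a) := by
      calc _ = b' * b * ((a' * a) * (b' * b)) * (a' * a) := by simp only [mul_assoc]
        _ = (b' * b * (b' * b)) * (a' * a * (a' * a)) := by rw [hc]; simp only [mul_assoc]
        _ = _ := by rw [hp, hq]
    have hidem : IsIdempotentElem (b' * b - b' * b * (a' * a)) := by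
      have h1 : b' * b * (b' * b * (a' * a)) = b' * b * (a' * a) := by
        rw [← mul_assoc, hq]
      have h2 : b' * b * (a' * a) * (b' * b) = b' * b * (a' * a) := by
        rw [mul_assoc, hc, ← mul_assoc, hq]
      rw [IsIdempotentElem, mul_sub, sub_mul, sub_mul, hq, h1, h2, hpq]
      abel
    have hform : b' * b - b' * b * (a' * a) = b' * (b - a) - b' * (b - a) * (a' * a) := by
      have h3 : b' * a * (a' * a) = b' * a := by
        rw [mul_assoc, ← mul_assoc a, ← ha.left]
      rw [mul_sub, sub_mul, h3]
      abel
    have hsmall : ‖b' * (b - a)‖ ≤ ‖b - a‖ :=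
      (norm_mul_le _ _).trans (mul_le_of_le_one_left (norm_nonneg _) hnb')
    have hpn : ‖a' * a‖ ≤ 1 := (norm_mul_le _ _).trans (mul_le_one₀ hna' (norm_nonneg _) hna)
    have hlt : ‖b' * b - b' * b * (a' * a)‖ < 1 := by
      rw [hform]
      calc _ ≤ ‖b' * (b - a)‖ + ‖b' * (b - a) * (a' * a)‖ := norm_sub_le _ _
        _ ≤ ‖b' * (b - a)‖ + ‖b' * (b - a)‖ := by
          gcongr
          exact (norm_mul_le _ _).trans (mul_le_of_le_one_right (norm_nonneg _) hpn)
        _ < 1 := by linarith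
    exact sub_eq_zero.mp (eq_zero_of_isIdempotentElem_of_norm_lt_one hidem hlt)
  rw [key b b' a a' hb ha hnb hnb' hna hna' (by rwa [norm_sub_rev]),
    hC _ _ ha.symm.isIdempotentElem ha.herm_right hb.symm.isIdempotentElem hb.herm_right]
  exact (key a a' b b' ha hb hna hna' hnb hnb' h).symm

/-- Once both pairs of projections agree, `b' - a' = b'(a - b)a'`. -/
theorem norm_mpInverse_sub_le (hC : HermitianIdempotentsCommute A) {a a' b b' : A}
    (ha : IsMPInverse a a') (hb : IsMPInverse b b') (hna : ‖a‖ ≤ 1) (hna' : ‖a'‖ ≤ 1)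
    (hnb : ‖b‖ ≤ 1) (hnb' : ‖b'‖ ≤ 1) (h : ‖b - a‖ < 1 / 2) : ‖b' - a'‖ ≤ ‖b - a‖ := by
  have h1 := mul_mpInverse_eq_of_norm_sub_lt hC ha hb hna hna' hnb hnb' h
  have h2 := mul_mpInverse_eq_of_norm_sub_lt' hC ha hb hna hna' hnb hnb' h
  have e1 : b' * a * a' = b' := by rw [mul_assoc, h1, ← mul_assoc, ← hb.right]
  have e2 : b' * b * a' = a' := by rw [← h2, ← ha.right]
  have hform : b' - a' = b' * (a - b) * a' := by rw [mul_sub, sub_mul, e1, e2]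
  rw [hform, norm_sub_rev b a]
  calc _ ≤ ‖b' * (a - b)‖ * ‖a'‖ := norm_mul_le _ _
    _ ≤ ‖b' * (a - b)‖ := mul_le_of_le_one_right (norm_nonneg _) hna'
    _ ≤ ‖b'‖ * ‖a - b‖ := norm_mul_le _ _
    _ ≤ ‖a - b‖ := mul_le_of_le_one_left (norm_nonneg _) hnb'

/-- The Moore-Penrose inverse is continuous on the set of MP-partial isometries. -/
theorem continuousOn_mpInverse (hC : HermitianIdempotentsCommute A) :
    ContinuousOn (mpInverse : A → A) (PIMP A) := by
  rw [Metric.continuousOn_iff]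
  intro a ha ε hε
  refine ⟨min ε (1 / 2), by positivity, fun b hb hab => ?_⟩
  rw [dist_eq_norm] at hab ⊢
  exact (norm_mpInverse_sub_le hC (isMPInverse_of_mem_PIMP ha) (isMPInverse_of_mem_PIMP hb)
    ha.2.1 ha.2.2 hb.2.1 hb.2.2 (hab.trans_le (min_le_right _ _))).trans_lt
    (hab.trans_le (min_le_left _ _))

/-- Uniqueness of generalized inverses is not an identity and need not pass to a quotient. The
hypotheses of `InverseSemigroup.ofCommute` are identities, so they do. -/
theorem exists_inverseSemigroup_PIMP (hA : ApproximatelyUnital A)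
    (hU : HermitianIdempotentsUltrahermitian A) (hC : HermitianIdempotentsCommute A) :
    ∃ (_ : InverseSemigroup (PIMP A)) (_ : InverseSemigroup (HomotopyClasses A)),
      (∀ a b : PIMP A, ((a * b : PIMP A) : A) = (a : A) * (b : A)) ∧
      (∀ a : PIMP A, ((a⁻¹ : PIMP A) : A) = mpInverse (a : A)) ∧
      (∀ a b : PIMP A,
        ZerothHomotopy.mk a * ZerothHomotopy.mk b = ZerothHomotopy.mk (a * b)) ∧
      (∀ a : PIMP A, (ZerothHomotopy.mk a)⁻¹ = ZerothHomotopy.mk a⁻¹) := by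
  let sg : Semigroup (PIMP A) :=
    { mul := fun a b => ⟨a * b, mul_mem_PIMP hA hU hC a.2 b.2⟩
      mul_assoc := fun a b c => Subtype.ext (mul_assoc (a : A) b c) }
  let iv : Inv (PIMP A) := ⟨fun a => ⟨mpInverse a, mpInverse_mem_PIMP hA a.2⟩⟩
  have hmul : ∀ a b : PIMP A, ((a * b : PIMP A) : A) = (a : A) * (b : A) := fun _ _ => rfl
  have hinv : ∀ a : PIMP A, ((a⁻¹ : PIMP A) : A) = mpInverse (a : A) := fun _ => rfl
  have hmp : ∀ a : PIMP A, IsMPInverse (a : A) (mpInverse (a : A)) :=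
    fun a => isMPInverse_of_mem_PIMP a.2
  have h1 : ∀ s : PIMP A, s = s * s⁻¹ * s := fun s => Subtype.ext (hmp s).left
  have h2 : ∀ s : PIMP A, s⁻¹⁻¹ = s := fun s => Subtype.ext (mpInverse_mpInverse hA s.2)
  have hc : ∀ s t : PIMP A, (s * s⁻¹) * (t * t⁻¹) = (t * t⁻¹) * (s * s⁻¹) := fun s t =>
    Subtype.ext (hC _ _ (hmp s).isIdempotentElem (hmp s).herm_left
      (hmp t).isIdempotentElem (hmp t).herm_left)
  have cmul : Continuous fun q : PIMP A × PIMP A => q.1 * q.2 :=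
    Continuous.subtype_mk (by fun_prop) _
  have cinv : Continuous fun a : PIMP A => a⁻¹ :=
    Continuous.subtype_mk (continuousOn_iff_continuous_domRestrict.mp (continuousOn_mpInverse hC)) _
  have jmul : ∀ a a' b b' : PIMP A, Joined a a' → Joined b b' → Joined (a * b) (a' * b') := by
    rintro a a' b b' ⟨γ⟩ ⟨δ⟩
    exact ⟨(γ.prod δ).map cmul⟩
  let sgq : Semigroup (HomotopyClasses A) :=
    { mul := Quotient.map₂ (fun a b => a * b) fun _ _ ha _ _ hb => jmul _ _ _ _ ha hb
      mul_assoc := by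
        rintro ⟨a⟩ ⟨b⟩ ⟨c⟩
        exact congrArg ZerothHomotopy.mk (mul_assoc a b c) }
  let ivq : Inv (HomotopyClasses A) :=
    ⟨Quotient.map (fun a => a⁻¹) fun _ _ ha => Joined.map ha cinv⟩
  refine ⟨InverseSemigroup.ofCommute h1 h2 hc, InverseSemigroup.ofCommute ?_ ?_ ?_, hmul, hinv,
    fun _ _ => rfl, fun _ => rfl⟩
  · rintro ⟨s⟩
    exact congrArg ZerothHomotopy.mk (h1 s)
  · rintro ⟨s⟩
    exact congrArg ZerothHomotopy.mk (h2 s)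
  · rintro ⟨s⟩ ⟨t⟩
    exact congrArg ZerothHomotopy.mk (hc s t)

end MoorePenrose

/-! ### The duality map of `L^p` -/

section Pointwise

open ComplexConjugate

/-- The pointwise duality map `z ↦ |z|^(r-2) z̄`. -/
noncomputable def dualMap (r : ℝ) (z : ℂ) : ℂ := ((‖z‖ ^ (r - 2) : ℝ) : ℂ) * conj z

theorem norm_dualMap {r : ℝ} (hr : 1 < r) (z : ℂ) : ‖dualMap r z‖ = ‖z‖ ^ (r - 1) := by
  rw [dualMap, norm_mul, Complex.norm_real, RCLike.norm_conj, Real.norm_of_nonneg (by positivity)]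
  rcases eq_or_ne z 0 with rfl | hz
  · rw [norm_zero, mul_zero, Real.zero_rpow (by linarith)]
  · rw [← Real.rpow_add_one (norm_ne_zero_iff.mpr hz)]
    ring_nf

theorem mul_dualMap {r : ℝ} (hr : 1 < r) (z : ℂ) : z * dualMap r z = ((‖z‖ ^ r : ℝ) : ℂ) := by
  rw [dualMap, mul_left_comm, Complex.mul_conj, Complex.normSq_eq_norm_sq, ← Complex.ofReal_mul]
  congr 1
  rcases eq_or_ne z 0 with rfl | hz
  · rw [norm_zero, Real.zero_rpow (by linarith : r ≠ 0)]; simp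
  · rw [← Real.rpow_natCast, ← Real.rpow_add (norm_pos_iff.mpr hz)]
    norm_num

theorem continuous_dualMap {r : ℝ} (hr : 1 < r) : Continuous (dualMap r) := by
  rw [continuous_iff_continuousAt]
  intro z
  rcases eq_or_ne z 0 with rfl | hz
  · have h0 : dualMap r 0 = 0 := by simp [dualMap]
    rw [ContinuousAt, h0, tendsto_zero_iff_norm_tendsto_zero]
    simp only [norm_dualMap hr]
    have : ContinuousAt (fun z : ℂ => ‖z‖ ^ (r - 1)) 0 :=
      continuous_norm.continuousAt.rpow_const (Or.inr (by linarith))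
    rw [ContinuousAt, norm_zero, Real.zero_rpow (by linarith)] at this
    exact this
  · have h1 : ContinuousAt (fun z : ℂ => ‖z‖ ^ (r - 2)) z :=
      continuous_norm.continuousAt.rpow_const (Or.inl (norm_ne_zero_iff.mpr hz))
    exact (Complex.continuous_ofReal.continuousAt.comp h1).mul
      Complex.continuous_conj.continuousAt

/-- Young's inequality for `r` and `r/(r-1)`. As `z * dualMap r z = |z|^r`, it says that `r *
dualMap r z` is a subgradient of `|·|^r` at `z`. -/
theorem re_mul_dualMap_le {r : ℝ} (hr : 1 < r) (w z : ℂ) :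
    r * (w * dualMap r z).re ≤ (r - 1) * ‖z‖ ^ r + ‖w‖ ^ r := by
  have hr0 : 0 < r := by linarith
  have hr1 : r - 1 ≠ 0 := by linarith
  have hpq : Real.HolderConjugate r (r / (r - 1)) :=
    (Real.holderConjugate_iff_eq_conjExponent hr).mpr rfl
  have h1 : (w * dualMap r z).re ≤ ‖w‖ * ‖z‖ ^ (r - 1) := by
    refine (Complex.re_le_norm _).trans ?_
    rw [norm_mul, norm_dualMap hr]
  have h2 := Real.young_inequality ‖w‖ (‖z‖ ^ (r - 1)) hpq
  rw [abs_of_nonneg (norm_nonneg _), abs_of_nonneg (by positivity),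
    ← Real.rpow_mul (norm_nonneg _), mul_div_cancel₀ r hr1] at h2
  have h3 := mul_le_mul_of_nonneg_left (h1.trans h2) hr0.le
  refine h3.trans (le_of_eq ?_)
  field_simp
  ring

/-- Strict convexity or concavity of `x^s`: `α + t` and `α - t` are convex combinations of `α + u`
and `α - u` with swapped weights, and the two inequalities add up. -/
theorem rpow_add_sub_ne {s α t u : ℝ} (hs : 0 < s) (hs1 : s ≠ 1) (ht : 0 ≤ t) (htu : t < u)
    (hu : u ≤ α) : (α + t) ^ s + (α - t) ^ s ≠ (α + u) ^ s + (α - u) ^ s := by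
  have hu0 : 0 < u := by linarith
  have hx : α + u ∈ Set.Ici (0 : ℝ) := Set.mem_Ici.mpr (by linarith)
  have hy : α - u ∈ Set.Ici (0 : ℝ) := Set.mem_Ici.mpr (by linarith)
  have hxy : α + u ≠ α - u := by intro h; linarith
  have ha : 0 < (u + t) / (2 * u) := by positivity
  have hb : 0 < (u - t) / (2 * u) := div_pos (by linarith) (by linarith)
  have hab : (u + t) / (2 * u) + (u - t) / (2 * u) = 1 := by field_simp; ring
  have e1 : (u + t) / (2 * u) * (α + u) + (u - t) / (2 * u) * (α - u) = α + t := by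
    field_simp; ring
  have e2 : (u - t) / (2 * u) * (α + u) + (u + t) / (2 * u) * (α - u) = α - t := by
    field_simp; ring
  rcases lt_or_gt_of_ne hs1 with h | h
  · have hc := (Real.strictConcaveOn_rpow hs h).2 hx hy hxy
    have h1 := hc ha hb hab
    have h2 := hc hb ha (by rw [add_comm]; exact hab)
    simp only [smul_eq_mul] at h1 h2
    rw [e1] at h1
    rw [e2] at h2
    refine (ne_of_lt ?_).symm
    calc _ = ((u + t) / (2 * u) + (u - t) / (2 * u)) * ((α + u) ^ s + (α - u) ^ s) := by
          rw [hab, one_mul]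
      _ < _ := by linarith
  · have hc := (strictConvexOn_rpow h).2 hx hy hxy
    have h1 := hc ha hb hab
    have h2 := hc hb ha (by rw [add_comm]; exact hab)
    simp only [smul_eq_mul] at h1 h2
    rw [e1] at h1
    rw [e2] at h2
    refine ne_of_lt ?_
    calc _ < ((u + t) / (2 * u) + (u - t) / (2 * u)) * ((α + u) ^ s + (α - u) ^ s) := by linarith
      _ = _ := by rw [hab, one_mul]

theorem abs_eq_of_rpow_add_sub_eq {s α t u : ℝ} (hs : 0 < s) (hs1 : s ≠ 1) (ht : |t| ≤ α)
    (hu : |u| ≤ α) (h : (α + t) ^ s + (α - t) ^ s = (α + u) ^ s + (α - u) ^ s) : |t| = |u| := by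
  have habs : ∀ x : ℝ, (α + |x|) ^ s + (α - |x|) ^ s = (α + x) ^ s + (α - x) ^ s := by
    intro x
    rcases abs_choice x with hx | hx <;> rw [hx]
    rw [sub_neg_eq_add, add_comm, ← sub_eq_add_neg]
  rw [← habs t, ← habs u] at h
  rcases lt_trichotomy |t| |u| with h1 | h1 | h1
  · exact absurd h (rpow_add_sub_ne hs hs1 (abs_nonneg _) h1 hu)
  · exact h1
  · exact absurd h.symm (rpow_add_sub_ne hs hs1 (abs_nonneg _) h1 ht)

/-- For `r ≠ 2` the duality map is affine along a circle only in the trivial cases. -/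
theorem mul_eq_zero_of_dualMap_affine {r : ℝ} (hr : 1 < r) (hr2 : r ≠ 2) {a b A B : ℂ}
    (h : ∀ z ∈ ({1, Complex.I, ⟨3 / 5, 4 / 5⟩} : Finset ℂ),
      dualMap r (z * a + b) = conj z * A + B ∧ dualMap r (-z * a + b) = conj (-z) * A + B) :
    a * b = 0 := by
  set c : ℂ := 2 * (a * conj b) with hc
  set α : ℝ := ‖a‖ ^ 2 + ‖b‖ ^ 2 with hα
  have hcn : ‖c‖ ≤ α := by
    rw [hc, norm_mul, norm_mul, RCLike.norm_conj, Complex.norm_ofNat]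
    nlinarith [sq_nonneg (‖a‖ - ‖b‖)]
  have hsq : ∀ z : ℂ, ‖z‖ = 1 → ‖z * a + b‖ ^ 2 = α + (z * c).re := by
    intro z hz
    have h1 := Complex.normSq_add (z * a) b
    simp only [Complex.normSq_eq_norm_sq, norm_mul, hz, one_mul] at h1
    rw [h1, hα, hc]
    congr 1
    have : z * (2 * (a * conj b)) = ((2 : ℝ) : ℂ) * (z * a * conj b) := by push_cast; ring
    rw [this, Complex.re_ofReal_mul]
  have hJ : ∀ z : ℂ, ‖z‖ = 1 → ‖dualMap r (z * a + b)‖ ^ 2 = (α + (z * c).re) ^ (r - 1) := by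
    intro z hz
    rw [norm_dualMap hr, ← hsq z hz, ← Real.rpow_natCast, ← Real.rpow_natCast,
      ← Real.rpow_mul (norm_nonneg _), ← Real.rpow_mul (norm_nonneg _), mul_comm (r - 1)]
  -- The parallelogram law for the affine values at `z` and `-z` gives a right-hand side that does
  -- not depend on `z`.
  have hconst : ∀ z : ℂ, ‖z‖ = 1 → dualMap r (z * a + b) = conj z * A + B →
      dualMap r (-z * a + b) = conj (-z) * A + B →
      (α + (z * c).re) ^ (r - 1) + (α - (z * c).re) ^ (r - 1) = 2 * (‖A‖ ^ 2 + ‖B‖ ^ 2) := by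
    intro z hz h1 h2
    have h3 := hJ z hz
    have h4 := hJ (-z) (by rw [norm_neg, hz])
    rw [neg_mul z c, Complex.neg_re, ← sub_eq_add_neg] at h4
    rw [← h3, ← h4, h1, h2]
    have h5 := parallelogram_law_with_norm ℝ B (conj z * A)
    rw [norm_mul, RCLike.norm_conj, hz, one_mul] at h5
    have e1 : conj z * A + B = B + conj z * A := add_comm _ _
    have e2 : conj (-z) * A + B = B - conj z * A := by rw [map_neg]; ring
    rw [e1, e2]
    nlinarith [h5]
  have hzc : ∀ z : ℂ, ‖z‖ = 1 → |(z * c).re| ≤ α := by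
    intro z hz
    refine (Complex.abs_re_le_norm _).trans ?_
    rwa [norm_mul, hz, one_mul]
  have hs : 0 < r - 1 := by linarith
  have hs1 : r - 1 ≠ 1 := fun h => hr2 (by linarith)
  have hω : ‖(⟨3 / 5, 4 / 5⟩ : ℂ)‖ = 1 := by
    rw [← sq_eq_sq₀ (norm_nonneg _) zero_le_one, ← Complex.normSq_eq_norm_sq,
      Complex.normSq_mk]
    norm_num
  -- The points `1` and `I` give `(re c)² = (im c)²`; then `(3 + 4i)/5` gives `re c * im c = 0`.
  obtain ⟨a1, a2⟩ := h 1 (by simp)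
  obtain ⟨b1, b2⟩ := h Complex.I (by simp)
  obtain ⟨c1, c2⟩ := h ⟨3 / 5, 4 / 5⟩ (by simp)
  have k1 := hconst _ (by simp) a1 a2
  have k2 := hconst _ (by simp) b1 b2
  have k3 := hconst _ hω c1 c2
  have m1 := abs_eq_of_rpow_add_sub_eq hs hs1 (hzc 1 (by simp)) (hzc Complex.I (by simp))
    (k1.trans k2.symm)
  have m2 := abs_eq_of_rpow_add_sub_eq hs hs1 (hzc 1 (by simp)) (hzc _ hω) (k1.trans k3.symm)
  rw [← sq_eq_sq_iff_abs_eq_abs] at m1 m2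
  simp only [Complex.mul_re, Complex.one_re, Complex.one_im, Complex.I_re, Complex.I_im] at m1 m2
  have hx : c.re * c.im = 0 := by nlinarith
  have hre : c.re = 0 := by
    rcases mul_eq_zero.mp hx with h' | h'
    · exact h'
    · rw [h'] at m1; nlinarith
  have him : c.im = 0 := by rw [hre] at m1; nlinarith
  have hc0 : c = 0 := Complex.ext hre him
  rw [hc] at hc0
  simpa using hc0

end Pointwise

/-! ### The pairing of `L^p` with `L^q` and the duality map on functions -/

section Lp

variable {X : Type v} [MeasurableSpace X] {μ : Measure X} {p q : ℝ≥0∞}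

theorem norm_rpow_eq_integral [Fact (1 ≤ p)] (hp : p ≠ ⊤) (x : Lp ℂ p μ) :
    ‖x‖ ^ p.toReal = ∫ a, ‖x a‖ ^ p.toReal ∂μ := by
  have h0 : p ≠ 0 := (zero_lt_one.trans_le Fact.out).ne'
  have hpos : 0 < p.toReal := ENNReal.toReal_pos h0 hp
  have hi : 0 ≤ ∫ a, ‖x a‖ ^ p.toReal ∂μ := integral_nonneg fun a => by positivity
  rw [Lp.norm_def, (Lp.memLp x).eLpNorm_eq_integral_rpow_norm h0 hp,
    ENNReal.toReal_ofReal (by positivity), ← Real.rpow_mul hi, inv_mul_cancel₀ hpos.ne',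
    Real.rpow_one]

theorem integrable_norm_rpow_Lp [Fact (1 ≤ p)] (hp : p ≠ ⊤) (x : Lp ℂ p μ) :
    Integrable (fun a => ‖x a‖ ^ p.toReal) μ :=
  (Lp.memLp x).integrable_norm_rpow (zero_lt_one.trans_le Fact.out).ne' hp

/-- The `p`-th power of the norm is additive on disjointly supported functions. -/
theorem norm_add_rpow_of_disjoint [Fact (1 ≤ p)] (hp : p ≠ ⊤) (x y : Lp ℂ p μ)
    (h : ∀ᵐ a ∂μ, x a * y a = 0) :
    ‖x + y‖ ^ p.toReal = ‖x‖ ^ p.toReal + ‖y‖ ^ p.toReal := by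
  have hpos : 0 < p.toReal :=
    ENNReal.toReal_pos (zero_lt_one.trans_le Fact.out).ne' hp
  rw [norm_rpow_eq_integral hp, norm_rpow_eq_integral hp, norm_rpow_eq_integral hp,
    ← integral_add (integrable_norm_rpow_Lp hp x) (integrable_norm_rpow_Lp hp y)]
  refine integral_congr_ae ?_
  filter_upwards [h, Lp.coeFn_add x y] with a ha hadd
  rw [hadd, Pi.add_apply]
  rcases mul_eq_zero.mp ha with h0 | h0 <;> simp [h0, Real.zero_rpow hpos.ne']

theorem memLp_dualMap [p.HolderConjugate q] (hp1 : 1 < p) (hp : p ≠ ⊤) (x : Lp ℂ p μ) :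
    MemLp (fun a => dualMap p.toReal (x a)) q μ := by
  have hr : 1 < p.toReal := by
    rwa [← ENNReal.toReal_one, ENNReal.toReal_lt_toReal ENNReal.one_ne_top hp]
  have hq := ENNReal.HolderConjugate.toReal (q := q) hr
  have h1 := (Lp.memLp x).norm_rpow_div (ENNReal.ofReal (p.toReal - 1))
  rw [ENNReal.toReal_ofReal (by linarith)] at h1
  have hqt : q ≠ ⊤ := by
    intro h
    have := hq.symm.pos
    simp [h] at this
  have hpq : p / ENNReal.ofReal (p.toReal - 1) = q := by
    rw [← ENNReal.ofReal_toReal hp, ← ENNReal.ofReal_toReal hqt, ENNReal.toReal_ofReal (by linarith),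
      ← ENNReal.ofReal_div_of_pos (by linarith), hq.conjugate_eq]
  rw [hpq] at h1
  refine h1.of_le ((continuous_dualMap hr).comp_aestronglyMeasurable
    (Lp.aestronglyMeasurable x)) (Eventually.of_forall fun a => ?_)
  rw [norm_dualMap hr, Real.norm_of_nonneg (by positivity)]

variable [Fact (1 ≤ p)] [Fact (1 ≤ q)] [p.HolderConjugate q]

/-- The functional on `L^p` given by integration against a function in `L^q`. -/
noncomputable def pairing (k : Lp ℂ q μ) : Lp ℂ p μ →L[ℂ] ℂ :=
  (ContinuousLinearMap.lpPairing μ p q (ContinuousLinearMap.mul ℂ ℂ)).flip k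

theorem pairing_apply (k : Lp ℂ q μ) (x : Lp ℂ p μ) : pairing k x = ∫ a, x a * k a ∂μ := by
  simp [pairing, ContinuousLinearMap.lpPairing_eq_integral]

end Lp

section Lp

open ComplexConjugate

variable {X : Type v} [MeasurableSpace X] {μ : Measure X} {p q : ℝ≥0∞}

theorem one_lt_toReal (hp1 : 1 < p) (hp : p ≠ ⊤) : 1 < p.toReal := by
  rwa [← ENNReal.toReal_one, ENNReal.toReal_lt_toReal ENNReal.one_ne_top hp]

variable (q) in
/-- The duality map `L^p → L^q`. -/
noncomputable def dualLp [p.HolderConjugate q] (hp1 : 1 < p) (hp : p ≠ ⊤) (x : Lp ℂ p μ) :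
    Lp ℂ q μ :=
  (memLp_dualMap (q := q) hp1 hp x).toLp _

theorem coeFn_dualLp [p.HolderConjugate q] (hp1 : 1 < p) (hp : p ≠ ⊤) (x : Lp ℂ p μ) :
    dualLp q hp1 hp x =ᵐ[μ] fun a => dualMap p.toReal (x a) :=
  MemLp.coeFn_toLp _

variable [Fact (1 ≤ p)] [Fact (1 ≤ q)] [p.HolderConjugate q]

/-- Indicators of sets of finite measure suffice as test functions because `q` is finite; no
σ-finiteness of `μ` is needed. -/
theorem eq_of_forall_pairing_eq (hq : q ≠ ⊤) {k k' : Lp ℂ q μ}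
    (h : ∀ x : Lp ℂ p μ, pairing k x = pairing k' x) : k = k' := by
  have h1 : (1 : ℝ≥0∞) ≤ q := Fact.out
  rw [← sub_eq_zero, Lp.eq_zero_iff_ae_eq_zero]
  refine Lp.ae_eq_zero_of_forall_setIntegral_eq_zero (k - k') (zero_lt_one.trans_le h1).ne' hq
    (fun s _ hs => ?_) (fun s hs hμ => ?_)
  · have : IsFiniteMeasure (μ.restrict s) := ⟨by simpa using hs⟩
    exact ((Lp.memLp (k - k')).restrict s).integrable h1
  · have h2 := h (indicatorConstLp p hs hμ.ne 1)
    have h3 : pairing (k - k') (indicatorConstLp p hs hμ.ne (1 : ℂ)) = 0 := by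
      rw [← sub_eq_zero] at h2
      simpa [pairing] using h2
    rw [pairing_apply] at h3
    rw [← integral_indicator hs, ← h3]
    refine integral_congr_ae ?_
    filter_upwards [indicatorConstLp_coeFn (p := p) (hs := hs) (hμs := hμ.ne) (c := (1 : ℂ))]
      with a ha
    rw [ha]
    by_cases has : a ∈ s <;> simp [has]

variable (hp1 : 1 < p) (hp : p ≠ ⊤)

theorem pairing_dualLp (x y : Lp ℂ p μ) :
    pairing (dualLp q hp1 hp x) y = ∫ a, y a * dualMap p.toReal (x a) ∂μ := by
  rw [pairing_apply]
  refine integral_congr_ae ?_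
  filter_upwards [coeFn_dualLp (q := q) hp1 hp x] with a ha
  rw [ha]

theorem pairing_dualLp_self (x : Lp ℂ p μ) :
    pairing (dualLp q hp1 hp x) x = ((‖x‖ ^ p.toReal : ℝ) : ℂ) := by
  rw [pairing_dualLp, norm_rpow_eq_integral hp, ← integral_complex_ofReal]
  simp only [mul_dualMap (one_lt_toReal hp1 hp)]

theorem re_pairing_dualLp_le (x y : Lp ℂ p μ) :
    p.toReal * (pairing (dualLp q hp1 hp x) y).re
      ≤ (p.toReal - 1) * ‖x‖ ^ p.toReal + ‖y‖ ^ p.toReal := by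
  have hi : Integrable (fun a => y a * dualMap p.toReal (x a)) μ :=
    (Lp.memLp y).integrable_mul (memLp_dualMap (q := q) hp1 hp x)
  have hre : (∫ a, y a * dualMap p.toReal (x a) ∂μ).re
      = ∫ a, (y a * dualMap p.toReal (x a)).re ∂μ := (integral_re hi).symm
  rw [pairing_dualLp, hre, norm_rpow_eq_integral hp, norm_rpow_eq_integral hp,
    ← integral_const_mul, ← integral_const_mul,
    ← integral_add ((integrable_norm_rpow_Lp hp x).const_mul _) (integrable_norm_rpow_Lp hp y)]
  exact integral_mono (hi.re.const_mul _)
    (((integrable_norm_rpow_Lp hp x).const_mul _).add (integrable_norm_rpow_Lp hp y))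
    fun a => re_mul_dualMap_le (one_lt_toReal hp1 hp) _ _

/-- This is the smoothness of the norm used below. For `|t| < 1` the integrand is dominated by `(|x|
+ |y|)^p`. -/
theorem tendsto_pairing_dualLp_add_smul (x y : Lp ℂ p μ) :
    Tendsto (fun t : ℝ => pairing (dualLp q hp1 hp (x + (t : ℂ) • y)) y) (𝓝 0)
      (𝓝 (pairing (dualLp q hp1 hp x) y)) := by
  have hr := one_lt_toReal hp1 hp
  simp only [pairing_dualLp]
  have hcoe : ∀ t : ℝ, ∀ᵐ a ∂μ, (x + (t : ℂ) • y) a = x a + t * y a := by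
    intro t
    filter_upwards [Lp.coeFn_add x ((t : ℂ) • y), Lp.coeFn_smul (t : ℂ) y] with a h1 h2
    rw [h1, Pi.add_apply, h2, Pi.smul_apply, smul_eq_mul]
  have hint : ∀ t : ℝ, ∫ a, y a * dualMap p.toReal ((x + (t : ℂ) • y) a) ∂μ
      = ∫ a, y a * dualMap p.toReal (x a + t * y a) ∂μ := fun t => by
    refine integral_congr_ae ?_
    filter_upwards [hcoe t] with a ha
    rw [ha]
  simp only [hint]
  have hb : Integrable (fun a => (‖x a‖ + ‖y a‖) ^ p.toReal) μ := by
    have h1 : MemLp (fun a => ‖x a‖ + ‖y a‖) p μ := (Lp.memLp x).norm.add (Lp.memLp y).norm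
    refine (h1.integrable_norm_rpow (zero_lt_one.trans hp1).ne' hp).congr
      (Eventually.of_forall fun a => ?_)
    simp only [Real.norm_of_nonneg (add_nonneg (norm_nonneg (x a)) (norm_nonneg (y a)))]
  refine tendsto_integral_filter_of_dominated_convergence _ (Eventually.of_forall fun t => ?_) ?_
    hb ?_
  · exact (Lp.aestronglyMeasurable y).mul
      ((continuous_dualMap hr).comp_aestronglyMeasurable
        ((Lp.aestronglyMeasurable x).add ((Lp.aestronglyMeasurable y).const_mul _)))
  · filter_upwards [Metric.ball_mem_nhds (0 : ℝ) one_pos] with t ht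
    refine Eventually.of_forall fun a => ?_
    have ht' : |t| ≤ 1 := by simpa using (Metric.mem_ball.mp ht).le
    have h1 : ‖x a + t * y a‖ ≤ ‖x a‖ + ‖y a‖ := by
      refine (norm_add_le _ _).trans (add_le_add_right ?_ _)
      rw [norm_mul, Complex.norm_real, Real.norm_eq_abs]
      exact mul_le_of_le_one_left (norm_nonneg _) ht'
    rw [norm_mul, norm_dualMap hr]
    calc ‖y a‖ * ‖x a + t * y a‖ ^ (p.toReal - 1)
        ≤ (‖x a‖ + ‖y a‖) * (‖x a‖ + ‖y a‖) ^ (p.toReal - 1) := by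
          refine mul_le_mul (by linarith [norm_nonneg (x a)])
            (Real.rpow_le_rpow (norm_nonneg _) h1 (by linarith)) (by positivity) (by positivity)
      _ = (‖x a‖ + ‖y a‖) ^ p.toReal := by
          rw [mul_comm, ← Real.rpow_add_one' (by positivity) (by linarith), sub_add_cancel]
  · refine Eventually.of_forall fun a => ?_
    have hc : Continuous fun t : ℝ => y a * dualMap p.toReal (x a + t * y a) :=
      continuous_const.mul ((continuous_dualMap hr).comp (by fun_prop))
    simpa using hc.tendsto 0

/-- If contractions `C i` satisfy `C i η → ξ` with `‖η‖ ≤ ‖ξ‖`, then their transposes applied to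
the support functional of `ξ` converge weakly to the support functional of `η`. -/
theorem tendsto_pairing_dualLp {ι : Type*} {l : Filter ι} {C : ι → Lp ℂ p μ →L[ℂ] Lp ℂ p μ}
    (hC : ∀ᶠ i in l, ‖C i‖ ≤ 1) {ξ η : Lp ℂ p μ} (h : Tendsto (fun i => C i η) l (𝓝 ξ))
    (hn : ‖η‖ ≤ ‖ξ‖) (x : Lp ℂ p μ) :
    Tendsto (fun i => pairing (dualLp q hp1 hp ξ) (C i x)) l
      (𝓝 (pairing (dualLp q hp1 hp η) x)) := by
  set r := p.toReal with hrdef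
  have hr : 1 < r := one_lt_toReal hp1 hp
  set L : Lp ℂ p μ → Lp ℂ p μ →L[ℂ] ℂ := fun y => pairing (dualLp q hp1 hp y) with hL
  have hself : ∀ y, (L y y).re = ‖y‖ ^ r := fun y => by
    simp only [hL, pairing_dualLp_self, Complex.ofReal_re, hrdef]
  have hle : ∀ y z, r * (L y z).re ≤ (r - 1) * ‖y‖ ^ r + ‖z‖ ^ r :=
    fun y z => re_pairing_dualLp_le hp1 hp y z
  -- Adding the subgradient inequalities for `(ξ, C y)` and `(y, η)` at `y = η + t x` bounds `L ξ (C
  -- x)` by `L y x` plus an error divided by `t`. As `t` is fixed before `i`, an error `tδ/2` in `L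
  -- ξ (C η)` is affordable. Lower bounds come from `-x`, imaginary parts from `I • x`.
  have upper : ∀ x : Lp ℂ p μ, ∀ δ > 0, ∀ᶠ i in l, (L ξ (C i x)).re < (L η x).re + δ := by
    intro x δ hδ
    have h1 : Tendsto (fun t : ℝ => (L (η + (t : ℂ) • x) x).re) (𝓝[>] 0) (𝓝 (L η x).re) :=
      ((Complex.continuous_re.tendsto _).comp
        (tendsto_pairing_dualLp_add_smul (q := q) hp1 hp η x)).mono_left nhdsWithin_le_nhds
    have h2 : ∀ᶠ t : ℝ in 𝓝[>] 0, (L (η + (t : ℂ) • x) x).re < (L η x).re + δ / 2 :=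
      h1.eventually (gt_mem_nhds (by linarith))
    obtain ⟨t, ht, ht0⟩ := (h2.and self_mem_nhdsWithin).exists
    replace ht0 : 0 < t := ht0
    have h3 : Tendsto (fun i => (L ξ (C i η)).re) l (𝓝 (‖ξ‖ ^ r)) := by
      rw [← hself ξ]
      exact (Complex.continuous_re.tendsto _).comp (((L ξ).continuous.tendsto ξ).comp h)
    have h4 : ∀ᶠ i in l, ‖ξ‖ ^ r - t * δ / 2 < (L ξ (C i η)).re :=
      h3.eventually (lt_mem_nhds (by linarith [mul_pos ht0 hδ]))
    filter_upwards [h4, hC] with i hi hCi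
    set y := η + (t : ℂ) • x with hy
    have e1 : (L ξ (C i y)).re = (L ξ (C i η)).re + t * (L ξ (C i x)).re := by
      rw [hy, map_add, map_add, map_smul, map_smul, Complex.add_re, smul_eq_mul,
        Complex.re_ofReal_mul]
    have e2 : (L y η).re = ‖y‖ ^ r - t * (L y x).re := by
      rw [← hself y, eq_sub_iff_add_eq, ← Complex.re_ofReal_mul, ← smul_eq_mul, ← map_smul,
        ← Complex.add_re, ← map_add]
    have i1 := hle ξ (C i y)
    have i2 := hle y η
    have i3 : ‖C i y‖ ^ r ≤ ‖y‖ ^ r :=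
      Real.rpow_le_rpow (norm_nonneg _) (by
        simpa using (C i).le_of_opNorm_le hCi y) (by linarith)
    have i4 : ‖η‖ ^ r ≤ ‖ξ‖ ^ r := Real.rpow_le_rpow (norm_nonneg _) hn (by linarith)
    rw [e1] at i1
    rw [e2] at i2
    have i5 : r * (t * (L ξ (C i x)).re) < r * (t * ((L η x).re + δ)) := by
      have i6 := mul_lt_mul_of_pos_left hi (by linarith : 0 < r)
      have i7 := mul_lt_mul_of_pos_left ht (mul_pos (by linarith : 0 < r) ht0)
      nlinarith
    exact lt_of_mul_lt_mul_left (lt_of_mul_lt_mul_left i5 (by linarith)) ht0.le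
  have re_tendsto : ∀ x : Lp ℂ p μ,
      Tendsto (fun i => (L ξ (C i x)).re) l (𝓝 (L η x).re) := by
    intro x
    rw [tendsto_order]
    refine ⟨fun a ha => ?_, fun a ha => ?_⟩
    · filter_upwards [upper (-x) ((L η x).re - a) (by linarith)] with i hi
      simp only [map_neg, Complex.neg_re] at hi
      linarith
    · filter_upwards [upper x (a - (L η x).re) (by linarith)] with i hi
      linarith
  have him : ∀ z : ℂ, z.im = -(Complex.I * z).re := fun z => by simp
  have im_tendsto : Tendsto (fun i => (L ξ (C i x)).im) l (𝓝 (L η x).im) := by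
    simp only [him, ← smul_eq_mul, ← map_smul]
    exact (re_tendsto (Complex.I • x)).neg
  have := ((Complex.continuous_ofReal.tendsto _).comp (re_tendsto x)).add
    (((Complex.continuous_ofReal.tendsto _).comp im_tendsto).mul_const Complex.I)
  simpa only [Function.comp_def, Complex.re_add_im] using this

end Lp

/-! ### Disjoint supports from approximate circle actions, `p ≠ 2` -/

section Circle

open ComplexConjugate

variable {X : Type v} [MeasurableSpace X] {μ : Measure X} {p : ℝ≥0∞} [Fact (1 ≤ p)]

/-- Let `p ≠ 2`. If the circle acts approximately by contractions on `L^p`, then its eigenvectors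
for the characters `λ` and `1` are disjointly supported. -/
theorem ae_mul_eq_zero_of_circle_contractions (hp1 : 1 < p) (hp : p ≠ ⊤) (hp2 : p ≠ 2) {ι : Type*} {l : Filter ι} [l.NeBot]
    {Y Z : ι → Lp ℂ p μ →L[ℂ] Lp ℂ p μ}
    (hC : ∀ w : ℂ, ‖w‖ = 1 → ∀ᶠ i in l, ‖Z i + w • Y i‖ ≤ 1) {f g : Lp ℂ p μ}
    (hYf : Tendsto (fun i => Y i f) l (𝓝 f)) (hYg : Tendsto (fun i => Y i g) l (𝓝 0))
    (hZf : Tendsto (fun i => Z i f) l (𝓝 0)) (hZg : Tendsto (fun i => Z i g) l (𝓝 g)) :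
    ∀ᵐ a ∂μ, f a * g a = 0 := by
  obtain ⟨q, hpq⟩ : ∃ q : ℝ≥0∞, p.HolderConjugate q :=
    ⟨_, ENNReal.HolderConjugate.conjExponent Fact.out⟩
  have hq1 : Fact (1 ≤ q) := ⟨hpq.symm.one_le⟩
  have hqt : q ≠ ⊤ := by
    rintro rfl
    exact hp1.ne' ((ENNReal.HolderConjugate.eq_top_iff_eq_one _ _).mp rfl)
  have hlim : ∀ w u : ℂ, Tendsto (fun i => (Z i + w • Y i) (u • f + g)) l
      (𝓝 ((w * u) • f + g)) := by
    intro w u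
    have h1 := ((hZf.const_smul u).add hZg).add (((hYf.const_smul u).add hYg).const_smul w)
    simp only [smul_zero, zero_add, add_zero, smul_smul] at h1
    rw [add_comm ((w * u) • f)]
    refine h1.congr fun i => ?_
    simp [smul_smul]
  have hnorm : ∀ w u : ℂ, ‖w‖ = 1 → ‖(w * u) • f + g‖ ≤ ‖u • f + g‖ := by
    intro w u hw
    refine le_of_tendsto (hlim w u).norm ?_
    filter_upwards [hC w hw] with i hi
    simpa using (Z i + w • Y i).le_of_opNorm_le hi (u • f + g)
  have hconj : ∀ w : ℂ, ‖w‖ = 1 → conj w * w = 1 := fun w hw => by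
    rw [mul_comm, Complex.mul_conj, Complex.normSq_eq_norm_sq, hw]; simp
  -- The contraction with parameter `conj w` undoes the rotation: in the limit it carries `w • f +
  -- g` to `f + g`.
  have hpair : ∀ w : ℂ, ‖w‖ = 1 → ∀ x : Lp ℂ p μ,
      Tendsto (fun i => pairing (dualLp q hp1 hp (f + g)) ((Z i + conj w • Y i) x)) l
        (𝓝 (pairing (dualLp q hp1 hp (w • f + g)) x)) := by
    intro w hw x
    refine tendsto_pairing_dualLp hp1 hp (hC (conj w) (by rwa [RCLike.norm_conj])) ?_ ?_ x
    · have := hlim (conj w) w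
      rwa [hconj w hw, one_smul] at this
    · have := hnorm w 1 hw
      rwa [mul_one, one_smul] at this
  -- The operators are affine in `conj w`, hence so are the weak limits; the values at `w = 1` and
  -- `w = -1` determine the two coefficients.
  have hkey : ∀ w : ℂ, ‖w‖ = 1 → dualLp q hp1 hp (w • f + g)
      = conj w • ((1 / 2 : ℂ) • (dualLp q hp1 hp (f + g) - dualLp q hp1 hp (-f + g)))
        + (1 / 2 : ℂ) • (dualLp q hp1 hp (f + g) + dualLp q hp1 hp (-f + g)) := by
    intro w hw
    refine eq_of_forall_pairing_eq (p := p) hqt fun x => ?_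
    have h1 := hpair 1 (by simp) x
    have h2 := hpair (-1) (by simp) x
    have h3 := hpair w hw x
    rw [one_smul] at h1
    rw [neg_one_smul] at h2
    have h4 := ((h1.sub h2).const_mul (conj w * (1 / 2))).add ((h1.add h2).const_mul (1 / 2))
    refine (tendsto_nhds_unique h3 (h4.congr fun i => ?_)).trans ?_
    · simp only [map_one, map_neg, add_apply, smul_apply,
        map_add, map_smul, smul_eq_mul]
      ring
    · simp only [pairing, map_add, map_sub, map_smul, add_apply,
        sub_apply, smul_apply, smul_eq_mul]
      ring
  have hae : ∀ w : ℂ, ‖w‖ = 1 → ∀ᵐ a ∂μ, dualMap p.toReal (w * f a + g a)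
      = conj w * ((1 / 2 : ℂ) * (dualMap p.toReal (f a + g a) - dualMap p.toReal (-f a + g a)))
        + (1 / 2 : ℂ) * (dualMap p.toReal (f a + g a) + dualMap p.toReal (-f a + g a)) := by
    intro w hw
    set u := dualLp q hp1 hp (f + g)
    set v := dualLp q hp1 hp (-f + g)
    filter_upwards [coeFn_dualLp (q := q) hp1 hp (w • f + g), Lp.coeFn_add (w • f) g,
      Lp.coeFn_smul w f, coeFn_dualLp (q := q) hp1 hp (f + g), Lp.coeFn_add f g,
      coeFn_dualLp (q := q) hp1 hp (-f + g), Lp.coeFn_add (-f) g, Lp.coeFn_neg f,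
      Lp.coeFn_add (conj w • ((1 / 2 : ℂ) • (u - v))) ((1 / 2 : ℂ) • (u + v)),
      Lp.coeFn_smul (conj w) ((1 / 2 : ℂ) • (u - v)), Lp.coeFn_smul (1 / 2 : ℂ) (u - v),
      Lp.coeFn_smul (1 / 2 : ℂ) (u + v), Lp.coeFn_sub u v, Lp.coeFn_add u v]
      with a h1 h2 h3 h4 h5 h6 h7 h8 h9 h10 h11 h12 h13 h14
    rw [hkey w hw, h9, Pi.add_apply, h10, h12, Pi.smul_apply, Pi.smul_apply, h11, Pi.smul_apply,
      h13, h14, Pi.sub_apply, Pi.add_apply, h2, Pi.add_apply, h3, Pi.smul_apply] at h1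
    change u a = _ at h4
    change v a = _ at h6
    rw [h4, h6, h5, h7, Pi.add_apply, Pi.add_apply, h8, Pi.neg_apply] at h1
    simpa only [smul_eq_mul] using h1.symm
  have hr2 : p.toReal ≠ 2 := by
    intro h
    apply hp2
    rw [← ENNReal.ofReal_toReal hp, h]
    simp
  have hω : ∀ z ∈ ({1, Complex.I, ⟨3 / 5, 4 / 5⟩} : Finset ℂ), ‖z‖ = 1 := by
    intro z hz
    simp only [Finset.mem_insert, Finset.mem_singleton] at hz
    rcases hz with rfl | rfl | rfl
    · simp
    · simp
    · rw [← sq_eq_sq₀ (norm_nonneg _) zero_le_one, ← Complex.normSq_eq_norm_sq,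
        Complex.normSq_mk]
      norm_num
  -- Only finitely many `w` are used, so a single null set serves them all.
  have hall := (Finset.eventually_all _).mpr fun z hz =>
    (hae z (hω z hz)).and (hae (-z) (by rw [norm_neg, hω z hz]))
  filter_upwards [hall] with a ha
  exact mul_eq_zero_of_dualMap_affine (one_lt_toReal hp1 hp) hr2 ha

end Circle

/-! ### The circle acting on `L^1` -/

section LOne

open ComplexConjugate

variable {X : Type v} [MeasurableSpace X] {μ : Measure X}

/-- The Cayley transform `(1 + is)/(1 - is)` is such a point. -/
theorem exists_circle_near_one {s : ℝ} (hs : 0 < s) :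
    ∃ w : ℂ, ‖w‖ = 1 ∧ 0 < ‖w - 1‖ ∧ ‖w - 1‖ ≤ 2 * s := by
  have h1 : (1 : ℝ) ≤ ‖(1 - s * Complex.I : ℂ)‖ := by
    have := Complex.re_le_norm (1 - s * Complex.I : ℂ)
    simpa using this
  have h0 : (1 - s * Complex.I : ℂ) ≠ 0 := norm_pos_iff.mp (by linarith)
  have hc : conj (1 - s * Complex.I : ℂ) = 1 + s * Complex.I := by simp
  have h2 : ‖(1 + s * Complex.I : ℂ)‖ = ‖(1 - s * Complex.I : ℂ)‖ := by
    rw [← hc, RCLike.norm_conj]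
  have h3 : (1 + s * Complex.I : ℂ) / (1 - s * Complex.I) - 1
      = 2 * s * Complex.I / (1 - s * Complex.I) := by
    field_simp
    ring
  have h4 : ‖(2 * s * Complex.I : ℂ)‖ = 2 * s := by simp [abs_of_pos hs]
  refine ⟨(1 + s * Complex.I) / (1 - s * Complex.I), ?_, ?_, ?_⟩
  · rw [norm_div, h2, div_self (by linarith)]
  · rw [h3, norm_div, h4]
    positivity
  · rw [h3, norm_div, h4]
    exact div_le_self (by linarith) h1

/-- First-order terms cancel between `w` and its conjugate: `(w - 1) + (conj w - 1) = -|w - 1|²`. -/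
theorem two_mul_norm_sub_le {w : ℂ} (hw : ‖w‖ = 1) (z y : ℂ) :
    2 * ‖z‖ - ‖w - 1‖ ^ 2 * ‖y‖ ≤ ‖z + (w - 1) * y‖ + ‖z + (conj w - 1) * y‖ := by
  have h1 : (z + (w - 1) * y) + (z + (conj w - 1) * y)
      = 2 * z - ((‖w - 1‖ ^ 2 : ℝ) : ℂ) * y := by
    have h2 : ((‖w - 1‖ ^ 2 : ℝ) : ℂ) = 2 - w - conj w := by
      rw [← Complex.normSq_eq_norm_sq, Complex.normSq_eq_conj_mul_self, map_sub, map_one]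
      have h3 : conj w * w = 1 := by
        rw [← Complex.normSq_eq_conj_mul_self, Complex.normSq_eq_norm_sq, hw]; simp
      linear_combination h3
    rw [h2]
    ring
  refine le_trans ?_ (norm_add_le _ _)
  rw [h1]
  refine le_trans (le_of_eq ?_) (norm_sub_norm_le _ _)
  rw [norm_mul, norm_mul, Complex.norm_real, Complex.norm_ofNat,
    Real.norm_of_nonneg (by positivity)]

/-- The hypotheses say that the real and imaginary parts of `z * conj y` vanish. -/
theorem mul_eq_zero_of_norm_add_eq {z y : ℂ} (h1 : ‖-1 * z + y‖ = ‖z + y‖)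
    (h2 : ‖-1 * (Complex.I * z) + y‖ = ‖Complex.I * z + y‖) : z * y = 0 := by
  rw [← sq_eq_sq₀ (norm_nonneg _) (norm_nonneg _), ← Complex.normSq_eq_norm_sq,
    ← Complex.normSq_eq_norm_sq, Complex.normSq_add, Complex.normSq_add] at h1 h2
  simp at h1 h2
  have hre : z.re * y.re + z.im * y.im = 0 := by linarith
  have him : z.re * y.im - z.im * y.re = 0 := by linarith
  have h3 : z * conj y = 0 := by
    apply Complex.ext <;> simp <;> linarith
  simpa using h3

/-- The restriction of an integrable function to a measurable set. -/
noncomputable def restrictLOne {S : Set X} (hS : MeasurableSet S) (x : Lp ℂ 1 μ) : Lp ℂ 1 μ :=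
  ((Lp.memLp x).indicator hS).toLp _

theorem coeFn_restrictLOne {S : Set X} (hS : MeasurableSet S) (x : Lp ℂ 1 μ) :
    restrictLOne hS x =ᵐ[μ] S.indicator x :=
  MemLp.coeFn_toLp _

variable [Fact (1 ≤ (1 : ℝ≥0∞))] {e : Lp ℂ 1 μ →L[ℂ] Lp ℂ 1 μ}

/-- A hermitian operator on `L^1` does not enlarge supports. -/
theorem ae_eq_zero_of_eq_zero_of_circle_contractions
    (he : ∀ w : ℂ, ‖w‖ = 1 → ∀ x, ‖x + (w - 1) • e x‖ ≤ ‖x‖) (F : Lp ℂ 1 μ) :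
    ∀ᵐ a ∂μ, F a = 0 → e F a = 0 := by
  have hFm := Lp.stronglyMeasurable F
  set S : Set X := {a | F a = 0} with hS
  have hSm : MeasurableSet S := hFm.measurable (measurableSet_singleton 0)
  have hiF : Integrable (fun a => ‖F a‖) μ := (L1.integrable_coeFn F).norm
  have hie : Integrable (fun a => ‖e F a‖) μ := (L1.integrable_coeFn (e F)).norm
  set d := ∫ a, S.indicator (fun a => ‖e F a‖) a ∂μ with hd
  have hd0 : 0 ≤ d := integral_nonneg fun a => Set.indicator_nonneg (fun _ _ => norm_nonneg _) a
  -- Adding the norms for `w` and `conj w`, the zero set of `F` contributes the first-order term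
  -- `2ρd`, while the loss elsewhere is only of order `ρ²`. Contractivity bounds the sum by `2‖F‖`,
  -- so `2d ≤ ρ‖e F‖`.
  have hdle : ∀ s : ℝ, 0 < s → d ≤ s * ‖e F‖ := by
    intro s hs
    obtain ⟨w, hw, hρ, hρs⟩ := exists_circle_near_one hs
    set ρ := ‖w - 1‖ with hρdef
    have hint : ∫ a, ((2 * ‖F a‖ - ρ ^ 2 * ‖e F a‖)
        + 2 * ρ * S.indicator (fun a => ‖e F a‖) a) ∂μ
        ≤ ∫ a, (‖(F + (w - 1) • e F) a‖ + ‖(F + (conj w - 1) • e F) a‖) ∂μ := by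
      refine integral_mono_ae
        (((hiF.const_mul _).sub (hie.const_mul _)).add ((hie.indicator hSm).const_mul _))
        ((L1.integrable_coeFn _).norm.add (L1.integrable_coeFn _).norm) ?_
      filter_upwards [Lp.coeFn_add F ((w - 1) • e F), Lp.coeFn_smul (w - 1) (e F),
        Lp.coeFn_add F ((conj w - 1) • e F), Lp.coeFn_smul (conj w - 1) (e F)] with a h1 h2 h3 h4
      simp only [h1, h2, h3, h4, Pi.add_apply, Pi.smul_apply, smul_eq_mul]
      by_cases ha : a ∈ S
      · have ha' : F a = 0 := ha
        have hconj : ‖conj w - 1‖ = ρ := by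
          rw [hρdef, ← RCLike.norm_conj (w - 1), map_sub, map_one]
        rw [Set.indicator_of_mem ha, ha', norm_zero, zero_add, zero_add, norm_mul, norm_mul,
          hconj, ← hρdef]
        nlinarith [mul_nonneg (sq_nonneg ρ) (norm_nonneg (e F a))]
      · rw [Set.indicator_of_notMem ha, mul_zero, add_zero]
        exact two_mul_norm_sub_le hw _ _
    have hsub : Integrable (fun a => 2 * ‖F a‖ - ρ ^ 2 * ‖e F a‖) μ :=
      (hiF.const_mul _).sub (hie.const_mul _)
    rw [integral_add hsub ((hie.indicator hSm).const_mul _),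
      integral_sub (hiF.const_mul _) (hie.const_mul _),
      integral_const_mul, integral_const_mul, integral_const_mul,
      integral_add (L1.integrable_coeFn _).norm (L1.integrable_coeFn _).norm,
      ← L1.norm_eq_integral_norm, ← L1.norm_eq_integral_norm, ← L1.norm_eq_integral_norm,
      ← L1.norm_eq_integral_norm, ← hd] at hint
    have h1 := he w hw F
    have h2 := he (conj w) (by rwa [RCLike.norm_conj]) F
    have h3 : ρ * (2 * d) ≤ ρ * (ρ * ‖e F‖) := by nlinarith
    have h4 := le_of_mul_le_mul_left h3 hρ
    have h5 := mul_le_mul_of_nonneg_right hρs (norm_nonneg (e F))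
    linarith
  have hzero : d = 0 := by
    refine le_antisymm (le_of_forall_pos_le_add fun ε hε => ?_) hd0
    have h1 := hdle (ε / (‖e F‖ + 1)) (by positivity)
    refine h1.trans ?_
    rw [zero_add, div_mul_eq_mul_div, div_le_iff₀ (by positivity)]
    nlinarith [norm_nonneg (e F)]
  have hae := (integral_eq_zero_iff_of_nonneg
    (fun a => Set.indicator_nonneg (fun _ _ => norm_nonneg _) a) (hie.indicator hSm)).mp hzero
  filter_upwards [hae] with a ha h0
  rw [Set.indicator_of_mem (show a ∈ S from h0)] at ha
  simpa using ha

theorem norm_restrictLOne {S : Set X} (hS : MeasurableSet S) (x : Lp ℂ 1 μ) :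
    ‖restrictLOne hS x‖ = ∫ a in S, ‖x a‖ ∂μ := by
  rw [L1.norm_eq_integral_norm, ← integral_indicator hS]
  refine integral_congr_ae ?_
  filter_upwards [coeFn_restrictLOne hS x] with a ha
  rw [ha, norm_indicator_eq_indicator_norm]

/-- The parts of `x` on `S` and on its complement keep their supports under `e`, so `e` commutes
with cutting off. -/
theorem map_restrictLOne
    (he : ∀ w : ℂ, ‖w‖ = 1 → ∀ x, ‖x + (w - 1) • e x‖ ≤ ‖x‖) {S : Set X}
    (hS : MeasurableSet S) (x : Lp ℂ 1 μ) : e (restrictLOne hS x) = restrictLOne hS (e x) := by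
  have hsum : restrictLOne hS x + restrictLOne hS.compl x = x := by
    refine Lp.ext ?_
    filter_upwards [Lp.coeFn_add (restrictLOne hS x) (restrictLOne hS.compl x),
      coeFn_restrictLOne hS x, coeFn_restrictLOne hS.compl x] with a h1 h2 h3
    rw [h1, Pi.add_apply, h2, h3]
    by_cases ha : a ∈ S <;> simp [ha]
  have hesum : e (restrictLOne hS x) + e (restrictLOne hS.compl x) = e x := by
    rw [← map_add, hsum]
  refine Lp.ext ?_
  filter_upwards [coeFn_restrictLOne hS (e x), coeFn_restrictLOne hS x,
    coeFn_restrictLOne hS.compl x, ae_eq_zero_of_eq_zero_of_circle_contractions he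
      (restrictLOne hS x), ae_eq_zero_of_eq_zero_of_circle_contractions he
      (restrictLOne hS.compl x), Lp.coeFn_add (e (restrictLOne hS x))
      (e (restrictLOne hS.compl x))] with a h1 h2 h3 h4 h5 h6
  rw [hesum, Pi.add_apply] at h6
  rw [h1]
  by_cases ha : a ∈ S
  · rw [Set.indicator_of_mem ha, h6, h5 (by rw [h3]; simp [ha]), add_zero]
  · rw [Set.indicator_of_notMem ha, h4 (by rw [h2]; simp [ha])]

/-- Since `e` commutes with cutoffs, the norm inequality holds over every measurable set, hence
almost everywhere. -/
theorem ae_norm_le_of_circle_contractions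
    (he : ∀ w : ℂ, ‖w‖ = 1 → ∀ x, ‖x + (w - 1) • e x‖ ≤ ‖x‖) {f g : Lp ℂ 1 μ} (hf : e f = f)
    (hg : e g = 0) {w : ℂ} (hw : ‖w‖ = 1) : ∀ᵐ a ∂μ, ‖w * f a + g a‖ ≤ ‖f a + g a‖ := by
  have h1 : (fun a => ‖(w • f + g) a‖) ≤ᵐ[μ] fun a => ‖(f + g) a‖ := by
    refine ae_le_of_forall_setIntegral_le (L1.integrable_coeFn _).norm (L1.integrable_coeFn _).norm
      fun S hS _ => ?_
    rw [← norm_restrictLOne hS, ← norm_restrictLOne hS]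
    have h2 := he w hw (restrictLOne hS (f + g))
    rw [map_restrictLOne he, map_add, hf, hg, add_zero] at h2
    have h3 : restrictLOne hS (w • f + g)
        = restrictLOne hS (f + g) + (w - 1) • restrictLOne hS f := by
      refine Lp.ext ?_
      filter_upwards [coeFn_restrictLOne hS (w • f + g), Lp.coeFn_add (w • f) g,
        Lp.coeFn_smul w f, coeFn_restrictLOne hS (f + g), Lp.coeFn_add f g,
        coeFn_restrictLOne hS f, Lp.coeFn_add (restrictLOne hS (f + g))
        ((w - 1) • restrictLOne hS f), Lp.coeFn_smul (w - 1) (restrictLOne hS f)]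
        with a k1 k2 k3 k4 k5 k6 k7 k8
      rw [k1, k7, Pi.add_apply, k4, k8, Pi.smul_apply, k6]
      by_cases ha : a ∈ S
      · simp only [Set.indicator_of_mem ha, k2, k3, k5, Pi.add_apply, Pi.smul_apply, smul_eq_mul]
        ring
      · simp [ha]
    rwa [h3]
  filter_upwards [h1, Lp.coeFn_add (w • f) g, Lp.coeFn_smul w f, Lp.coeFn_add f g]
    with a k1 k2 k3 k4
  simpa only [k2, k3, k4, Pi.add_apply, Pi.smul_apply, smul_eq_mul] using k1

theorem ae_mul_eq_zero_of_circle_contractions_one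
    (he : ∀ w : ℂ, ‖w‖ = 1 → ∀ x, ‖x + (w - 1) • e x‖ ≤ ‖x‖) {f g : Lp ℂ 1 μ} (hf : e f = f)
    (hg : e g = 0) : ∀ᵐ a ∂μ, f a * g a = 0 := by
  have heig : ∀ w : ℂ, e (w • f) = w • f := fun w => by rw [map_smul, hf]
  have hm : ‖(-1 : ℂ)‖ = 1 := by simp
  filter_upwards [ae_norm_le_of_circle_contractions he hf hg hm,
    ae_norm_le_of_circle_contractions he (heig (-1)) hg hm,
    ae_norm_le_of_circle_contractions he (heig Complex.I) hg hm,
    ae_norm_le_of_circle_contractions he (heig (-Complex.I)) hg hm,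
    Lp.coeFn_smul (-1 : ℂ) f, Lp.coeFn_smul Complex.I f, Lp.coeFn_smul (-Complex.I) f]
    with a h1 h2 h3 h4 k1 k2 k3
  rw [k1, Pi.smul_apply, smul_eq_mul] at h2
  rw [k2, Pi.smul_apply, smul_eq_mul] at h3
  rw [k3, Pi.smul_apply, smul_eq_mul] at h4
  refine mul_eq_zero_of_norm_add_eq (le_antisymm h1 ?_) (le_antisymm h3 ?_)
  · simpa using h2
  · simpa using h4

end LOne

/-! ### Hermitian idempotents in `L^p`-operator algebras -/

section Representation

theorem IsHermitianUnital.norm_one_sub_add_smul_le {B : Type*} [NormedRing B] [NormedAlgebra ℂ B]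
    {e : B} (he : IsIdempotentElem e) (hh : IsHermitianUnital e) {w : ℂ} (hw : ‖w‖ = 1) :
    ‖(1 - e) + w • e‖ ≤ 1 := by
  obtain ⟨θ, hθ⟩ := (Complex.norm_eq_one_iff w).mp hw
  have h1 := (hh θ).le
  rwa [exp_smul_idempotent he, hθ] at h1

variable {A : Type u} [NonUnitalNormedRing A] [NormedSpace ℂ A]
  {X : Type v} [MeasurableSpace X] {μ : Measure X} {p : ℝ≥0∞} [Fact (1 ≤ p)]
  {φ : A →ₙₐ[ℂ] (Lp ℂ p μ →L[ℂ] Lp ℂ p μ)}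

/-- The images of `φ e` and `1 - φ e` on the essential space of `φ` are disjointly supported. -/
def SeparatesSupports (φ : A →ₙₐ[ℂ] (Lp ℂ p μ →L[ℂ] Lp ℂ p μ)) (e : A) : Prop :=
  ∀ (a b : A) (ζ ξ : Lp ℂ p μ), ∀ᵐ x ∂μ, φ (e * a) ζ x * φ (b - e * b) ξ x = 0

theorem norm_map_of_isometry (hφ : Isometry φ) (a : A) : ‖φ a‖ = ‖a‖ :=
  hφ.norm_map_of_map_zero (map_zero φ) a

theorem tendsto_map_apply (hφ : Isometry φ) {ι : Type*} {l : Filter ι} {c : ι → A} {d : A}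
    (h : Tendsto c l (𝓝 d)) (ζ : Lp ℂ p μ) : Tendsto (fun i => φ (c i) ζ) l (𝓝 (φ d ζ)) :=
  (((ContinuousLinearMap.apply ℂ (Lp ℂ p μ) ζ).continuous.comp hφ.continuous).tendsto d).comp h

/-- If `t ≠ 0` then `ξ = 0`, so `F = 0` and `s = -t`, contradicting `s * t = 0`. In the application
`F` is a value of `fξ`, and `s`, `t` are its components along `e` and `1 - e`. -/
theorem eq_zero_of_disjoint_decompositions {F ξ s t : ℂ} (h1 : F = s + t) (h2 : s * t = 0)
    (h3 : F * (ξ - F) = 0) (h4 : t * ξ = 0) : t = 0 := by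
  rcases mul_eq_zero.mp h4 with h | h
  · exact h
  · rw [h, zero_sub, mul_neg, neg_eq_zero, mul_self_eq_zero] at h3
    have h5 : s = -t := by linear_combination h3 - h1
    rw [h5, neg_mul, neg_eq_zero, mul_self_eq_zero] at h2
    exact h2

theorem SeparatesSupports.commute (hA : ApproximatelyUnital A) (hφ : Isometry φ) {e f : A}
    (he : IsIdempotentElem e) (hse : SeparatesSupports φ e) (hsf : SeparatesSupports φ f) :
    e * f = f * e := by
  have hzero : ∀ c : A, (∀ ζ : Lp ℂ p μ, φ c ζ = 0) → c = 0 := fun c hc =>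
    hφ.injective ((ContinuousLinearMap.ext hc).trans (map_zero φ).symm)
  have hap : ∀ c d : A, ∀ ζ : Lp ℂ p μ, φ (c + d) ζ = φ c ζ + φ d ζ := fun c d ζ => by
    rw [map_add, add_apply]
  -- split `f ξ` along `e` for `ξ` in the range of `e`
  have h1 : f * e - e * (f * e) = 0 := by
    refine hzero _ fun ζ => Lp.ext ?_
    have a1 : φ (f * e) ζ = φ (e * (f * e)) ζ + φ (f * e - e * (f * e)) ζ := by
      rw [← hap, add_sub_cancel]
    have a2 : φ e ζ = φ (f * e) ζ + φ (e - f * e) ζ := by rw [← hap, add_sub_cancel]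
    have k4 := hse e (f * e) ζ ζ
    rw [he] at k4
    filter_upwards [Lp.coeFn_add (φ (e * (f * e)) ζ) (φ (f * e - e * (f * e)) ζ),
      Lp.coeFn_add (φ (f * e) ζ) (φ (e - f * e) ζ), hse (f * e) (f * e) ζ ζ, hsf e e ζ ζ, k4,
      Lp.coeFn_zero ℂ p μ] with x b1 b2 b3 b4 b5 b6
    rw [← a1, Pi.add_apply] at b1
    rw [← a2, Pi.add_apply] at b2
    rw [b6]
    exact eq_zero_of_disjoint_decompositions b1 b3 (ξ := φ e ζ x)
      (by rw [b2, add_sub_cancel_left]; exact b4) (by rw [mul_comm]; exact b5)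
  -- split `f ξ` along `e` for `ξ` in the range of `1 - e`
  have h2 : ∀ b : A, e * (f * (b - e * b)) = 0 := by
    intro b
    set c := b - e * b with hc
    refine hzero _ fun ζ => Lp.ext ?_
    have a1 : φ (f * c) ζ = φ (f * c - e * (f * c)) ζ + φ (e * (f * c)) ζ := by
      rw [← hap, sub_add_cancel]
    have a2 : φ c ζ = φ (f * c) ζ + φ (c - f * c) ζ := by rw [← hap, add_sub_cancel]
    filter_upwards [Lp.coeFn_add (φ (f * c - e * (f * c)) ζ) (φ (e * (f * c)) ζ),
      Lp.coeFn_add (φ (f * c) ζ) (φ (c - f * c) ζ), hse (f * c) (f * c) ζ ζ, hsf c c ζ ζ,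
      hse (f * c) b ζ ζ, Lp.coeFn_zero ℂ p μ] with x b1 b2 b3 b4 b5 b6
    rw [← a1, Pi.add_apply] at b1
    rw [← a2, Pi.add_apply] at b2
    rw [b6]
    exact eq_zero_of_disjoint_decompositions b1 (by rw [mul_comm]; exact b3) (ξ := φ c ζ x)
      (by rw [b2, add_sub_cancel_left]; exact b4) b5
  -- `A` may lack a unit, so `1 - e` is approximated by `u - e * u`.
  obtain ⟨l, hl, -⟩ := hA
  have := hl.neBot
  have h3 : e * f - e * (f * e) = 0 := by
    refine tendsto_nhds_unique (hl.tendsto_mul_left _) (tendsto_const_nhds.congr fun u => ?_)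
    rw [← h2 u]
    simp only [mul_sub, sub_mul, mul_assoc]
  rw [sub_eq_zero.mp h3, ← sub_eq_zero.mp h1]

variable [IsScalarTower ℂ A A] [SMulCommClass ℂ A A]

theorem norm_add_smul_mul_le {e : A} (he : IsIdempotentElem e) (hh : IsHermitian e) {w : ℂ}
    (hw : ‖w‖ = 1) (b : A) : ‖b + (w - 1) • (e * b)‖ ≤ ‖b‖ := by
  have h1 := IsHermitianUnital.norm_one_sub_add_smul_le (B := MinUnitization A)
    (isIdempotentElem_toMinUnitization he) hh hw
  have h3 : (((1 - toMinUnitization e) + w • toMinUnitization e : MinUnitization A) : A →L[ℂ] A) b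
      = (b - e * b) + w • (e * b) := rfl
  have h4 : b + (w - 1) • (e * b) = (b - e * b) + w • (e * b) := by module
  rw [h4, ← h3]
  generalize (1 - toMinUnitization e) + w • toMinUnitization e = V at h1
  simpa using ContinuousLinearMap.le_of_opNorm_le (V : A →L[ℂ] A) h1 b

/-- Both `e` and `1 - e` are averages of `1` and `±(1 - 2e)`, the case `w = -1`. -/
theorem norm_idempotent_mul_le {e : A} (he : IsIdempotentElem e) (hh : IsHermitian e) (b : A) :
    ‖e * b‖ ≤ ‖b‖ ∧ ‖b - e * b‖ ≤ ‖b‖ := by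
  have h1 := norm_add_smul_mul_le he hh (w := -1) (by simp) b
  have e1 : e * b = (1 / 2 : ℂ) • (b - (b + ((-1 : ℂ) - 1) • (e * b))) := by module
  have e2 : b - e * b = (1 / 2 : ℂ) • (b + (b + ((-1 : ℂ) - 1) • (e * b))) := by module
  have h2 := norm_sub_le b (b + ((-1 : ℂ) - 1) • (e * b))
  have h3 := norm_add_le b (b + ((-1 : ℂ) - 1) • (e * b))
  constructor
  · rw [e1, norm_smul]
    norm_num
    norm_num at h1 h2
    linarith
  · rw [e2, norm_smul]
    norm_num
    norm_num at h1 h3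
    linarith

/-- As `φ` may be degenerate, `1 - e + we` need not act contractively on all of `L^p`. The
contractions `φ(u - eu + weu)`, with `u` from the approximate unit, have the right limits on vectors
`φ(c)ζ`. -/
theorem separatesSupports_of_one_lt (hA : ApproximatelyUnital A) (hp1 : 1 < p) (hp : p ≠ ⊤)
    (hp2 : p ≠ 2) (hφ : Isometry φ) {e : A} (he : IsIdempotentElem e) (hh : IsHermitian e) :
    SeparatesSupports φ e := by
  intro a b ζ ξ
  obtain ⟨l, hl, hl1⟩ := hA
  have := hl.neBot
  have hY : ∀ (c : A) (ζ : Lp ℂ p μ),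
      Tendsto (fun u => φ (e * u) (φ c ζ)) l (𝓝 (φ (e * c) ζ)) := by
    intro c ζ
    have h1 : Tendsto (fun u => e * (u * c)) l (𝓝 (e * c)) :=
      (hl.tendsto_mul_right c).const_mul e
    refine (tendsto_map_apply hφ h1 ζ).congr fun u => ?_
    rw [← mul_assoc, map_mul, mul_apply_eq_comp]
  have hI : ∀ (c : A) (ζ : Lp ℂ p μ), Tendsto (fun u => φ u (φ c ζ)) l (𝓝 (φ c ζ)) := by
    intro c ζ
    refine (tendsto_map_apply hφ (hl.tendsto_mul_right c) ζ).congr fun u => ?_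
    rw [map_mul, mul_apply_eq_comp]
  have hee : e * (e * a) = e * a := by rw [← mul_assoc, he]
  have heb : e * (b - e * b) = 0 := by rw [mul_sub, ← mul_assoc, he, sub_self]
  refine ae_mul_eq_zero_of_circle_contractions hp1 hp hp2 (l := l)
    (Y := fun u => φ (e * u)) (Z := fun u => φ u - φ (e * u)) ?_ ?_ ?_ ?_ ?_
  · intro w hw
    filter_upwards [hl1] with u hu
    have h1 : φ u - φ (e * u) + w • φ (e * u) = φ (u + (w - 1) • (e * u)) := by
      rw [map_add, map_smul]; module
    rw [h1, norm_map_of_isometry hφ]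
    exact (norm_add_smul_mul_le he hh hw u).trans hu
  · have := hY (e * a) ζ
    rwa [hee] at this
  · have := hY (b - e * b) ξ
    rwa [heb, map_zero] at this
  · have := (hI (e * a) ζ).sub (hY (e * a) ζ)
    rwa [hee, sub_self] at this
  · have := (hI (b - e * b) ξ).sub (hY (b - e * b) ξ)
    rwa [heb, map_zero, zero_apply, sub_zero] at this

/-- Nondegeneracy makes `φ(u)` converge to the identity on a dense subspace. A bound on the whole
space is needed for `L^1`, where cutting off by measurable sets can leave the essential space. -/
theorem norm_add_smul_map_le_of_dense (hA : ApproximatelyUnital A) (hφ : Isometry φ)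
    (hd : Dense (Submodule.span ℂ {η : Lp ℂ p μ | ∃ (a : A) (ξ : Lp ℂ p μ), η = φ a ξ} :
      Set (Lp ℂ p μ))) {e : A} (he : IsIdempotentElem e) (hh : IsHermitian e) {w : ℂ}
    (hw : ‖w‖ = 1) (x : Lp ℂ p μ) : ‖x + (w - 1) • φ e x‖ ≤ ‖x‖ := by
  obtain ⟨l, hl, hl1⟩ := hA
  have := hl.neBot
  refine hd.induction (P := fun x => ‖x + (w - 1) • φ e x‖ ≤ ‖x‖) (fun x hx => ?_)
    (isClosed_le (by fun_prop) continuous_norm) x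
  have hlim : Tendsto (fun u => φ u x) l (𝓝 x) := by
    induction hx using Submodule.span_induction with
    | mem y hy =>
      obtain ⟨a, ξ, rfl⟩ := hy
      refine (tendsto_map_apply hφ (hl.tendsto_mul_right a) ξ).congr fun u => ?_
      rw [map_mul, mul_apply_eq_comp]
    | zero => simp
    | add y z _ _ hy hz => simpa only [map_add] using hy.add hz
    | smul c y _ hy => simpa only [map_smul] using hy.const_smul c
  have h2 := (hlim.add ((((φ e).continuous.tendsto x).comp hlim).const_smul (w - 1))).norm
  refine le_of_tendsto h2 ?_
  filter_upwards [hl1] with u hu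
  have h3 : φ u x + (w - 1) • φ e (φ u x) = φ (u + (w - 1) • (e * u)) x := by
    rw [map_add, map_smul, map_mul]; rfl
  simp only [Function.comp_apply]
  rw [h3]
  have h4 : ‖φ (u + (w - 1) • (e * u))‖ ≤ 1 := by
    rw [norm_map_of_isometry hφ]
    exact (norm_add_smul_mul_le he hh hw u).trans hu
  simpa using (φ (u + (w - 1) • (e * u))).le_of_opNorm_le h4 x

theorem separatesSupports_of_dense [Fact (1 ≤ (1 : ℝ≥0∞))]
    {φ : A →ₙₐ[ℂ] (Lp ℂ 1 μ →L[ℂ] Lp ℂ 1 μ)} (hA : ApproximatelyUnital A) (hφ : Isometry φ)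
    (hd : Dense (Submodule.span ℂ {η : Lp ℂ 1 μ | ∃ (a : A) (ξ : Lp ℂ 1 μ), η = φ a ξ} :
      Set (Lp ℂ 1 μ))) {e : A} (he : IsIdempotentElem e) (hh : IsHermitian e) :
    SeparatesSupports φ e := by
  intro a b ζ ξ
  refine ae_mul_eq_zero_of_circle_contractions_one (e := φ e)
    (fun w hw x => norm_add_smul_map_le_of_dense hA hφ hd he hh hw x) ?_ ?_
  · rw [← mul_apply_eq_comp, ← map_mul, ← mul_assoc, he]
  · rw [← mul_apply_eq_comp, ← map_mul, mul_sub, ← mul_assoc, he, sub_self, map_zero,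
      zero_apply]

/-- Contractive left multipliers of `A` act contractively on the essential space of `φ`. -/
theorem norm_map_multiplier_apply_le (hA : ApproximatelyUnital A) (hφ : Isometry φ) {T : A → A}
    (hT : Continuous T) (hmul : ∀ c d, T (c * d) = T c * d) (hle : ∀ c, ‖T c‖ ≤ ‖c‖) (c : A)
    (ζ : Lp ℂ p μ) : ‖φ (T c) ζ‖ ≤ ‖φ c ζ‖ := by
  obtain ⟨l, hl, hl1⟩ := hA
  have := hl.neBot
  have h1 : Tendsto (fun u => T (u * c)) l (𝓝 (T c)) :=
    (hT.tendsto c).comp (hl.tendsto_mul_right c)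
  refine le_of_tendsto (tendsto_map_apply hφ h1 ζ).norm ?_
  filter_upwards [hl1] with u hu
  rw [hmul, map_mul, mul_apply_eq_comp]
  have h2 : ‖φ (T u)‖ ≤ 1 := by
    rw [norm_map_of_isometry hφ]
    exact (hle u).trans hu
  simpa using (φ (T u)).le_of_opNorm_le h2 (φ c ζ)

theorem minUnitization_apply_mul (x : MinUnitization A) (c d : A) :
    (x : A →L[ℂ] A) (c * d) = (x : A →L[ℂ] A) c * d := by
  obtain ⟨_, a, ν, rfl⟩ := x
  simp [mul_assoc, add_mul, smul_mul_assoc]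

/-- The components `eb` and `b - eb` are moved by contractive left multipliers into the ranges of
`e` and `1 - e`. Supports are disjoint before and after, so `p`-th powers of norms add on both
sides. -/
theorem SeparatesSupports.isUltrahermitian (hA : ApproximatelyUnital A) (hp : p ≠ ⊤)
    (hφ : Isometry φ) {e : A} (he : IsIdempotentElem e) (hh : IsHermitian e)
    (hs : SeparatesSupports φ e) : IsUltrahermitian e := by
  refine ⟨isIdempotentElem_toMinUnitization he, fun x y hx hy => ?_⟩
  have hpos : 0 < p.toReal := ENNReal.toReal_pos (zero_lt_one.trans_le Fact.out).ne' hp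
  have hcontr : ∀ x : MinUnitization A, ‖x‖ ≤ 1 → ∀ c, ‖(x : A →L[ℂ] A) c‖ ≤ ‖c‖ := by
    intro x hx c
    simpa using ContinuousLinearMap.le_of_opNorm_le (x : A →L[ℂ] A) hx c
  refine ContinuousLinearMap.opNorm_le_bound _ zero_le_one fun b => ?_
  rw [one_mul]
  set X' : A →L[ℂ] A := (x : A →L[ℂ] A) with hX'
  set Y' : A →L[ℂ] A := (y : A →L[ℂ] A) with hY'
  change ‖e * X' (e * b) + (Y' (b - e * b) - e * Y' (b - e * b))‖ ≤ ‖b‖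
  rw [← norm_map_of_isometry hφ]
  refine ContinuousLinearMap.opNorm_le_bound _ (norm_nonneg _) fun ζ => ?_
  have h1 : ‖φ (e * X' (e * b)) ζ‖ ≤ ‖φ (e * b) ζ‖ := by
    refine norm_map_multiplier_apply_le hA hφ (T := fun c => e * X' c) (by fun_prop)
      (fun c d => ?_) (fun c => ?_) _ ζ
    · rw [hX', minUnitization_apply_mul, mul_assoc]
    · exact (norm_idempotent_mul_le he hh _).1.trans (hcontr x hx c)
  have h2 : ‖φ (Y' (b - e * b) - e * Y' (b - e * b)) ζ‖ ≤ ‖φ (b - e * b) ζ‖ := by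
    refine norm_map_multiplier_apply_le hA hφ (T := fun c => Y' c - e * Y' c) (by fun_prop)
      (fun c d => ?_) (fun c => ?_) _ ζ
    · rw [hY', minUnitization_apply_mul, sub_mul, mul_assoc]
    · exact (norm_idempotent_mul_le he hh _).2.trans (hcontr y hy c)
  have h3 : ‖φ (e * X' (e * b) + (Y' (b - e * b) - e * Y' (b - e * b))) ζ‖ ≤ ‖φ b ζ‖ := by
    rw [← Real.rpow_le_rpow_iff (norm_nonneg _) (norm_nonneg _) hpos]
    have hb : φ b ζ = φ (e * b) ζ + φ (b - e * b) ζ := by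
      rw [← add_apply, ← map_add, add_sub_cancel]
    rw [hb, map_add, add_apply, norm_add_rpow_of_disjoint hp _ _ (hs _ _ ζ ζ),
      norm_add_rpow_of_disjoint hp _ _ (hs _ _ ζ ζ)]
    exact add_le_add (Real.rpow_le_rpow (norm_nonneg _) h1 hpos.le)
      (Real.rpow_le_rpow (norm_nonneg _) h2 hpos.le)
  refine h3.trans ?_
  rw [← norm_map_of_isometry hφ b]
  exact (φ b).le_opNorm ζ

theorem hermitian_idempotents_of_separatesSupports (hA : ApproximatelyUnital A) (hp : p ≠ ⊤)
    (hφ : Isometry φ)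
    (h : ∀ e : A, IsIdempotentElem e → IsHermitian e → SeparatesSupports φ e) :
    HermitianIdempotentsUltrahermitian A ∧ HermitianIdempotentsCommute A :=
  ⟨fun e he hh => (h e he hh).isUltrahermitian hA hp hφ he hh,
    fun e f he hhe hf hhf => (h e he hhe).commute hA hφ he (h f hf hhf)⟩

end Representation

end MPInv

theorem mainTheorem10 (A : Type u) [NonUnitalNormedRing A] [NormedSpace ℂ A]
    [IsScalarTower ℂ A A] [SMulCommClass ℂ A A] [CompleteSpace A]
    (hA : MPInv.ApproximatelyUnital A) :
    (MPInv.HermitianIdempotentsUltrahermitian A → MPInv.HermitianIdempotentsCommute A →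
      ∃ (_ : MPInv.InverseSemigroup (MPInv.PIMP A))
        (_ : MPInv.InverseSemigroup (MPInv.HomotopyClasses A)),
        -- the operations of the inverse semigroup of MP-partial isometries
        (∀ a b : MPInv.PIMP A, ((a * b : MPInv.PIMP A) : A) = (a : A) * (b : A)) ∧
        (∀ a : MPInv.PIMP A, ((a⁻¹ : MPInv.PIMP A) : A) = MPInv.mpInverse (a : A)) ∧
        -- `[a] [b] = [a b]` and `[a]† = [a†]`: the quotient map is a homomorphism
        (∀ a b : MPInv.PIMP A,
          ZerothHomotopy.mk a * ZerothHomotopy.mk b = ZerothHomotopy.mk (a * b)) ∧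
        (∀ a : MPInv.PIMP A, (ZerothHomotopy.mk a)⁻¹ = ZerothHomotopy.mk a⁻¹)) ∧
    (∀ (p : ENNReal) [Fact (1 ≤ p)],
      (1 < p ∧ p < ⊤ ∧ p ≠ 2 ∧ MPInv.IsLpOperatorAlgebra.{u, v} A p) ∨
        (p = 1 ∧ MPInv.HasNondegenerateLpRepresentation.{u, v} A p) →
      MPInv.HermitianIdempotentsUltrahermitian A ∧ MPInv.HermitianIdempotentsCommute A) := by

  refine ⟨fun hU hC => MPInv.exists_inverseSemigroup_PIMP hA hU hC, fun p _ h => ?_⟩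
  rcases h with ⟨hp1, hp, hp2, X, _, μ, φ, hφ⟩ | ⟨rfl, X, _, μ, φ, hφ, hd⟩
  · exact MPInv.hermitian_idempotents_of_separatesSupports hA hp.ne hφ fun e he hh =>
      MPInv.separatesSupports_of_one_lt hA hp1 hp.ne hp2 hφ he hh
  · exact MPInv.hermitian_idempotents_of_separatesSupports hA ENNReal.one_ne_top hφ fun e he hh =>
      MPInv.separatesSupports_of_dense hA hφ hd he hh
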